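/- Let $k$ be a field of characteristic zero and let $(P,[\,,],\rhd)$ be a post-Lie algebra over $k$: $(P,[\,,])$ is a Lie algebra and $\rhd$ is a bilinear product with $x\rhd[y,z]=[x\rhd y,z]+[y,x\rhd z]$ and $[x,y]\rhd z=\bigl(x\rhd(y\rhd z)-(x\rhd y)\rhd z\bigr)-\bigl(y\rhd(x\rhd z)-(y\rhd x)\rhd z\bigr)$. Let $P=P^1\supseteq P^2\supseteq\cdots$ be a filtration by subspaces with $[P^p,P^q]\subseteq P^{p+q}$ and $P^p\rhd P^q\subseteq P^{p+q}$, for which $P$ is complete, i.e. $P\to\varprojlim_p P/P^p$ is bijective. Let $U(P)$, with product $\bullet$, be the enveloping algebra of $(P,[\,,])$. For $x\in P$ let $x\rhd\cdot$ denote the derivation of $(U(P),\bullet)$ that extends $x\rhd\cdot$ on $P$. The bracket $[\![x,y]\!]=x\rhd y-y\rhd x+[x,y]$ is a second Lie bracket on $P$, and the linear map from the enveloping algebra of $(P,[\![\,,]\!])$ to $U(P)$ with $\theta(1)=1$ and $\theta(xa)=x\bullet\theta(a)+x\rhd\theta(a)$ for $x\in P$ is bijective; let $*$ be the product on $U(P)$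 transported along $\theta$. The action of $(P,[\![\,,]\!])$ on $P$ by $\rhd$ extends to an action $A\rhd y$ of $(U(P),*)$ on $P$. Let $F^p\subseteq U(P)$ be spanned by the products $x_1\bullet\cdots\bullet x_n$ with $x_r\in P^{i_r}$ and $i_1+\cdots+i_n\ge p$, and let $\hat U(P)=\varprojlim_p U(P)/F^p$, to which $\bullet$, $*$ and the action on $P$ extend. Regard elements of $P$ as elements of $\hat U(P)$. Let $\exp^\bullet(x)=\sum_{n\ge0}x^{\bullet n}/n!$ for $x\in P$, and $\log^\bullet(1+s)=\sum_{n\ge1}(-1)^{n+1}s^{\bullet n}/n$ for $s$ in the augmentation ideal of $\hat U(P)$. Then for all $x,y\in P$ the elements $$x\,\sharp\,y:=\log^\bullet\bigl(\exp^\bullet(x)*\exp^\bullet(y)\bigr),\qquad x\overset{\bullet}{+}y:=\log^\bullet\bigl(\exp^\bullet(x)\bullet\exp^\bullet(y)\bigr)$$ of $\hat U(P)$ lie in $P$, and $$x\,\sharp\,y=x\overset{\bullet}{+}\bigl(\exp^\bullet(x)\rhd y\bigr).$$ If moreover $[\,,]=0$ (the pre-Lie case), then $x\overset{\bullet}{+}y=x+y$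 and $x\,\sharp\,y=x+\exp^\bullet(x)\rhd y$ for all $x,y\in P$. -/

import Mathlib

/-- A post-Lie algebra: a Lie algebra with a bilinear product `tri x y = x ▷ y`. -/
class PostLieAlgebra (k P : Type*) [CommRing k] [LieRing P] [LieAlgebra k P] where
  tri : P →ₗ[k] P →ₗ[k] P
  tri_lie : ∀ x y z : P, tri x ⁅y, z⁆ = ⁅tri x y, z⁆ + ⁅y, tri x z⁆
  lie_tri : ∀ x y z : P, tri ⁅x, y⁆ z =
    (tri x (tri y z) - tri (tri x y) z) - (tri y (tri x z) - tri (tri y x) z)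

namespace PostLieAlgebra

section Double

variable (k P : Type*) [CommRing k] [LieRing P] [LieAlgebra k P] [PostLieAlgebra k P]

/-- The vector space `P` with its second Lie bracket `⟦x, y⟧ = x ▷ y - y ▷ x + [x, y]`. -/
def Double (_k P : Type*) : Type _ := P

instance : AddCommGroup (Double k P) := inferInstanceAs (AddCommGroup P)
instance : Module k (Double k P) := inferInstanceAs (Module k P)

/-- The identity map from `P` to `P` with the second bracket. -/
def toDouble : P ≃ₗ[k] Double k P := LinearEquiv.refl k P

instance : LieRing (Double k P) where
  bracket x y := toDouble k P
    (tri (k := k) ((toDouble k P).symm x) ((toDouble k P).symm y)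
      - tri (k := k) ((toDouble k P).symm y) ((toDouble k P).symm x)
      + ⁅(toDouble k P).symm x, (toDouble k P).symm y⁆)
  add_lie x y z := by
    simp only [← map_add]; congr 1; simp only [map_add, add_lie, LinearMap.add_apply]; abel
  lie_add x y z := by
    simp only [← map_add]; congr 1; simp only [map_add, lie_add, LinearMap.add_apply]; abel
  lie_self x := by simp
  leibniz_lie x y z := by
    simp only [← map_add]; congr 1
    obtain ⟨x, rfl⟩ := (toDouble k P).surjective x
    obtain ⟨y, rfl⟩ := (toDouble k P).surjective y
    obtain ⟨z, rfl⟩ := (toDouble k P).surjective z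
    simp only [LinearEquiv.symm_apply_apply, map_add, map_sub, LinearMap.add_apply,
      LinearMap.sub_apply, tri_lie, lie_tri, lie_add, add_lie, lie_sub, sub_lie]
    rw [leibniz_lie x y z]
    simp only [← lie_skew (tri (k := k) _ _) y]
    abel

theorem double_lie (x y : P) : ⁅toDouble k P x, toDouble k P y⁆ =
    toDouble k P (tri (k := k) x y - tri (k := k) y x + ⁅x, y⁆) := rfl

instance : LieAlgebra k (Double k P) where
  lie_smul t x y := by
    obtain ⟨x, rfl⟩ := (toDouble k P).surjective x
    obtain ⟨y, rfl⟩ := (toDouble k P).surjective y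
    rw [← map_smul, double_lie, double_lie, ← map_smul]
    simp [smul_add, smul_sub]

end Double

section Derivation

variable {k : Type*} [CommRing k]

/-- The linear map `x ↦ j x + ε j (f x)` into the dual numbers over `A`. -/
noncomputable def dualLift {P A : Type*} [AddCommGroup P] [Module k P] [Ring A] [Algebra k A]
    (j : P →ₗ[k] A) (f : Module.End k P) : P →ₗ[k] TrivSqZeroExt A A :=
  (TrivSqZeroExt.inlAlgHom k A A).toLinearMap ∘ₗ j +
    (TrivSqZeroExt.inrHom A A).restrictScalars k ∘ₗ j ∘ₗ f

section
variable {P : Type*} [AddCommGroup P] [Module k P] (f : Module.End k P)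

/-- The derivation of the tensor algebra that extends `f`. -/
noncomputable def tensorDer : Module.End k (TensorAlgebra k P) :=
  ((TrivSqZeroExt.sndHom (TensorAlgebra k P) (TensorAlgebra k P)).restrictScalars k) ∘ₗ
    (TensorAlgebra.lift k (dualLift (TensorAlgebra.ι k) f)).toLinearMap

theorem tensorDer_fst (a : TensorAlgebra k P) :
    (TensorAlgebra.lift k (dualLift (TensorAlgebra.ι k) f) a).fst = a := by
  have : (TrivSqZeroExt.fstHom k (TensorAlgebra k P) (TensorAlgebra k P)).comp
      (TensorAlgebra.lift k (dualLift (TensorAlgebra.ι k) f)) = AlgHom.id k _ := by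
    ext x; simp [dualLift]
  exact DFunLike.congr_fun this a

@[simp] theorem tensorDer_ι (x : P) :
    tensorDer f (TensorAlgebra.ι k x) = TensorAlgebra.ι k (f x) := by
  simp [tensorDer, dualLift]

@[simp] theorem tensorDer_algebraMap (r : k) :
    tensorDer f (algebraMap k _ r) = 0 := by
  simp only [tensorDer, LinearMap.comp_apply, AlgHom.toLinearMap_apply, AlgHom.commutes]
  exact congrArg TrivSqZeroExt.snd
    (TrivSqZeroExt.algebraMap_eq_inl' k (TensorAlgebra k P) (TensorAlgebra k P) r)

theorem tensorDer_mul (a b : TensorAlgebra k P) :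
    tensorDer f (a * b) = tensorDer f a * b + a * tensorDer f b := by
  simp only [tensorDer, LinearMap.comp_apply, AlgHom.toLinearMap_apply, map_mul]
  have := TrivSqZeroExt.snd_mul (TensorAlgebra.lift k (dualLift (TensorAlgebra.ι k) f) a)
    (TensorAlgebra.lift k (dualLift (TensorAlgebra.ι k) f) b)
  rw [tensorDer_fst, tensorDer_fst] at this
  rw [add_comm]
  exact this
end

variable {P : Type*} [LieRing P] [LieAlgebra k P]

section
attribute [local instance] LieRing.ofAssociativeRing

variable (k P) in
/-- The canonical linear map `P → U(P)`. -/
noncomputable def incl : P →ₗ[k] UniversalEnvelopingAlgebra k P :=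
  (UniversalEnvelopingAlgebra.ι k : P →ₗ⁅k⁆ UniversalEnvelopingAlgebra k P)

theorem incl_lie (x y : P) :
    incl k P ⁅x, y⁆ = incl k P x * incl k P y - incl k P y * incl k P x :=
  (UniversalEnvelopingAlgebra.ι k : P →ₗ⁅k⁆ UniversalEnvelopingAlgebra k P).map_lie x y

/-- The algebra homomorphism `U(P) → A` that extends a linear map `f : P → A` with
`f [x, y] = f x f y - f y f x`. -/
noncomputable def envLift {A : Type*} [Ring A] [Algebra k A] (f : P →ₗ[k] A)
    (hf : ∀ x y, f ⁅x, y⁆ = f x * f y - f y * f x) : UniversalEnvelopingAlgebra k P →ₐ[k] A :=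
  UniversalEnvelopingAlgebra.lift k
    ({ f with map_lie' := fun {x y} => hf x y } : P →ₗ⁅k⁆ A)

@[simp] theorem envLift_incl {A : Type*} [Ring A] [Algebra k A] (f : P →ₗ[k] A)
    (hf : ∀ x y, f ⁅x, y⁆ = f x * f y - f y * f x) (x : P) :
    envLift f hf (incl k P x) = f x :=
  UniversalEnvelopingAlgebra.lift_ι_apply k _ x

theorem mkAlgHom_ι (x : P) :
    UniversalEnvelopingAlgebra.mkAlgHom k P (TensorAlgebra.ι k x) = incl k P x := rfl

theorem mkAlgHom_surjective :
    Function.Surjective (UniversalEnvelopingAlgebra.mkAlgHom k P) := Quotient.mk_surjective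

end

theorem env_induction {C : UniversalEnvelopingAlgebra k P → Prop}
    (h0 : ∀ r : k, C (algebraMap k _ r))
    (hι : ∀ x, C (incl k P x)) (hm : ∀ a b, C a → C b → C (a * b))
    (ha : ∀ a b, C a → C b → C (a + b)) (a : UniversalEnvelopingAlgebra k P) : C a := by
  obtain ⟨t, rfl⟩ := mkAlgHom_surjective a
  induction t using TensorAlgebra.induction with
  | algebraMap r => simpa using h0 r
  | ι x => exact hι x
  | mul a b h1 h2 => rw [map_mul]; exact hm _ _ h1 h2
  | add a b h1 h2 => rw [map_add]; exact ha _ _ h1 h2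

section
variable (f : Module.End k P)

theorem dualLift_lie (hf : ∀ y z, f ⁅y, z⁆ = ⁅f y, z⁆ + ⁅y, f z⁆) (x y : P) :
    dualLift (incl k P) f ⁅x, y⁆ =
    dualLift (incl k P) f x * dualLift (incl k P) f y -
      dualLift (incl k P) f y * dualLift (incl k P) f x := by
  ext
  · simp [dualLift, incl_lie]
  · simp [dualLift, hf, incl_lie]
    abel

variable (hf : ∀ y z, f ⁅y, z⁆ = ⁅f y, z⁆ + ⁅y, f z⁆)

/-- The derivation of the enveloping algebra that extends a derivation `f` of the Lie algebra. -/
noncomputable def envDer : Module.End k (UniversalEnvelopingAlgebra k P) :=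
  ((TrivSqZeroExt.sndHom (UniversalEnvelopingAlgebra k P)
      (UniversalEnvelopingAlgebra k P)).restrictScalars k) ∘ₗ
    (envLift (dualLift (incl k P) f) (dualLift_lie f hf)).toLinearMap

theorem envDer_fst (a : UniversalEnvelopingAlgebra k P) :
    (envLift (dualLift (incl k P) f) (dualLift_lie f hf) a).fst = a := by
  induction a using env_induction with
  | h0 r =>
    rw [AlgHom.commutes]
    exact congrArg TrivSqZeroExt.fst (TrivSqZeroExt.algebraMap_eq_inl' k
      (UniversalEnvelopingAlgebra k P) (UniversalEnvelopingAlgebra k P) r)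
  | hι x => simp [dualLift]
  | hm a b h1 h2 => rw [map_mul, TrivSqZeroExt.fst_mul, h1, h2]
  | ha a b h1 h2 => rw [map_add, TrivSqZeroExt.fst_add, h1, h2]

@[simp] theorem envDer_incl (x : P) : envDer f hf (incl k P x) = incl k P (f x) := by
  simp [envDer, dualLift]

@[simp] theorem envDer_algebraMap (r : k) : envDer f hf (algebraMap k _ r) = 0 := by
  simp only [envDer, LinearMap.comp_apply, AlgHom.toLinearMap_apply, AlgHom.commutes]
  exact congrArg TrivSqZeroExt.snd (TrivSqZeroExt.algebraMap_eq_inl' k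
      (UniversalEnvelopingAlgebra k P) (UniversalEnvelopingAlgebra k P) r)

theorem envDer_mul (a b : UniversalEnvelopingAlgebra k P) :
    envDer f hf (a * b) = envDer f hf a * b + a * envDer f hf b := by
  simp only [envDer, LinearMap.comp_apply, AlgHom.toLinearMap_apply, map_mul]
  have := TrivSqZeroExt.snd_mul (envLift (dualLift (incl k P) f) (dualLift_lie f hf) a)
    (envLift (dualLift (incl k P) f) (dualLift_lie f hf) b)
  rw [envDer_fst f hf, envDer_fst f hf] at this
  rw [add_comm]
  exact this
end

end Derivation

section TensorLevel

variable {k P : Type*} [CommRing k] [AddCommGroup P] [Module k P]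

/-- Tensors of degree at most `n`. -/
noncomputable def tensorLE (k P : Type*) [CommRing k] [AddCommGroup P] [Module k P] (n : ℕ) :
    Submodule k (TensorAlgebra k P) :=
  (1 ⊔ LinearMap.range (TensorAlgebra.ι k)) ^ n

theorem tensorLE_induction {C : (n : ℕ) → TensorAlgebra k P → Prop}
    (h0 : ∀ r : k, C 0 (algebraMap k _ r))
    (ha : ∀ n a b, C n a → C n b → C n (a + b))
    (hr : ∀ n (r : k) a, a ∈ tensorLE k P n → C n a → C (n + 1) (r • a))
    (hx : ∀ n x a, a ∈ tensorLE k P n → C n a → C (n + 1) (TensorAlgebra.ι k x * a))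
    (n : ℕ) (a : TensorAlgebra k P) (h : a ∈ tensorLE k P n) : C n a := by
  induction n generalizing a with
  | zero =>
    obtain ⟨r, rfl⟩ := Submodule.mem_one.1 (by simpa [tensorLE] using h)
    exact h0 r
  | succ n ih =>
    rw [tensorLE, pow_succ'] at h
    refine Submodule.mul_induction_on h (fun m hm b hb => ?_) (fun a b => ha _ a b)
    obtain ⟨c, hc, v, hv, rfl⟩ := Submodule.mem_sup.1 hm
    obtain ⟨r, rfl⟩ := Submodule.mem_one.1 hc
    obtain ⟨x, rfl⟩ := hv
    rw [add_mul, ← Algebra.smul_def]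
    exact ha _ _ _ (hr n r b hb (ih b hb)) (hx n x b hb (ih b hb))

theorem tensorLE_mono (n : ℕ) : tensorLE k P n ≤ tensorLE k P (n + 1) := by
  intro a ha
  rw [tensorLE, pow_succ', ← one_mul a]
  exact Submodule.mul_mem_mul (Submodule.mem_sup_left (Submodule.one_le.mp le_rfl)) ha

theorem ι_mul_mem (n : ℕ) (x : P) {a : TensorAlgebra k P} (h : a ∈ tensorLE k P n) :
    TensorAlgebra.ι k x * a ∈ tensorLE k P (n + 1) := by
  rw [tensorLE, pow_succ']
  exact Submodule.mul_mem_mul (Submodule.mem_sup_right ⟨x, rfl⟩) h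

theorem exists_mem_tensorLE (a : TensorAlgebra k P) : ∃ n, a ∈ tensorLE k P n := by
  have hm : ∀ (m n : ℕ), m ≤ n → tensorLE k P m ≤ tensorLE k P n :=
    fun m n h => monotone_nat_of_le_succ tensorLE_mono h
  induction a using TensorAlgebra.induction with
  | algebraMap r => exact ⟨0, by simp [tensorLE]⟩
  | ι x => exact ⟨1, by
      rw [tensorLE, pow_one]; exact Submodule.mem_sup_right ⟨x, rfl⟩⟩
  | mul a b h1 h2 =>
    obtain ⟨m, hm⟩ := h1
    obtain ⟨n, hn⟩ := h2
    exact ⟨m + n, by rw [tensorLE, pow_add]; exact Submodule.mul_mem_mul hm hn⟩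
  | add a b h1 h2 =>
    obtain ⟨m, h1⟩ := h1
    obtain ⟨n, h2⟩ := h2
    exact ⟨max m n, add_mem (hm _ _ (le_max_left _ _) h1) (hm _ _ (le_max_right _ _) h2)⟩

theorem tensorDer_mem (f : Module.End k P) (n : ℕ) (a : TensorAlgebra k P)
    (h : a ∈ tensorLE k P n) : tensorDer f a ∈ tensorLE k P n := by
  refine tensorLE_induction (C := fun n a => tensorDer f a ∈ tensorLE k P n)
    (fun r => ?_) (fun n a b h1 h2 => ?_) (fun n r a h ih => ?_) (fun n x a h ih => ?_) n a h
  · simp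
  · rw [map_add]; exact add_mem h1 h2
  · rw [map_smul]; exact Submodule.smul_mem _ _ (tensorLE_mono n ih)
  · rw [tensorDer_mul, tensorDer_ι]
    exact add_mem (ι_mul_mem n _ h) (ι_mul_mem n _ ih)

theorem tensorDer_add (f g : Module.End k P) (a : TensorAlgebra k P) :
    tensorDer (f + g) a = tensorDer f a + tensorDer g a := by
  induction a using TensorAlgebra.induction with
  | algebraMap r => simp
  | ι x => simp
  | mul a b h1 h2 => rw [tensorDer_mul, tensorDer_mul, tensorDer_mul, h1, h2]; noncomm_ring
  | add a b h1 h2 => rw [map_add, map_add, map_add, h1, h2]; abel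

theorem tensorDer_smul (r : k) (f : Module.End k P) (a : TensorAlgebra k P) :
    tensorDer (r • f) a = r • tensorDer f a := by
  induction a using TensorAlgebra.induction with
  | algebraMap r => simp
  | ι x => simp
  | mul a b h1 h2 =>
    rw [tensorDer_mul, tensorDer_mul, h1, h2, smul_add, smul_mul_assoc, mul_smul_comm]
  | add a b h1 h2 => rw [map_add, map_add, h1, h2, smul_add]

theorem tensorDer_comm (f g h : Module.End k P)
    (H : ∀ x, h x = f (g x) - g (f x)) (a : TensorAlgebra k P) :
    tensorDer h a = tensorDer f (tensorDer g a) - tensorDer g (tensorDer f a) := by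
  induction a using TensorAlgebra.induction with
  | algebraMap r => simp
  | ι x => simp [H]
  | mul a b h1 h2 => simp only [tensorDer_mul, map_add, h1, h2]; noncomm_ring
  | add a b h1 h2 => simp only [map_add, h1, h2]; abel

variable (t : P →ₗ[k] P →ₗ[k] P)

/-- The linear map `x ↦ (a ↦ x a + D_x a)`, where `D_x` extends `t x`. -/
noncomputable def tensorOp : P →ₗ[k] Module.End k (TensorAlgebra k P) where
  toFun x := LinearMap.mulLeft k (TensorAlgebra.ι k x) + tensorDer (t x)
  map_add' x y := by
    ext1 a; simp [add_mul, tensorDer_add]; abel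
  map_smul' r x := by
    ext1 a; simp [tensorDer_smul]

/-- The linear map `θ` with `θ 1 = 1` and `θ (x a) = x θ a + D_x (θ a)`. -/
noncomputable def tensorTheta : Module.End k (TensorAlgebra k P) :=
  LinearMap.applyₗ (1 : TensorAlgebra k P) ∘ₗ (TensorAlgebra.lift k (tensorOp t)).toLinearMap

theorem tensorTheta_ι_mul (x : P) (a : TensorAlgebra k P) :
    tensorTheta t (TensorAlgebra.ι k x * a) =
      TensorAlgebra.ι k x * tensorTheta t a + tensorDer (t x) (tensorTheta t a) := by
  simp [tensorTheta, tensorOp]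

@[simp] theorem tensorTheta_algebraMap (r : k) :
    tensorTheta t (algebraMap k _ r) = algebraMap k _ r := by
  simp [tensorTheta, Algebra.algebraMap_eq_smul_one]

theorem tensorTheta_sub_mem (n : ℕ) (a : TensorAlgebra k P) (h : a ∈ tensorLE k P n) :
    tensorTheta t a - a ∈ tensorLE k P (n - 1) ∧ (n = 0 → tensorTheta t a = a) := by
  refine tensorLE_induction
    (C := fun n a => tensorTheta t a - a ∈ tensorLE k P (n - 1) ∧ (n = 0 → tensorTheta t a = a))
    (fun r => ?_) (fun n a b h1 h2 => ?_) (fun n r a h ih => ?_) (fun n x a h ih => ?_) n a h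
  · simp
  · refine ⟨?_, fun h => by rw [map_add, h1.2 h, h2.2 h]⟩
    rw [map_add, add_sub_add_comm]; exact add_mem h1.1 h2.1
  · refine ⟨?_, fun h => by omega⟩
    rw [map_smul, ← smul_sub]
    refine Submodule.smul_mem _ _ ?_
    exact monotone_nat_of_le_succ tensorLE_mono (by omega : n - 1 ≤ n + 1 - 1) ih.1
  · refine ⟨?_, fun h => by omega⟩
    have h1 : tensorTheta t a ∈ tensorLE k P n := by
      have := add_mem (monotone_nat_of_le_succ tensorLE_mono (by omega : n - 1 ≤ n) ih.1) h
      simpa using this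
    rw [tensorTheta_ι_mul, add_sub_right_comm, ← mul_sub]
    refine add_mem ?_ (tensorDer_mem _ _ _ h1)
    rcases n with _ | n
    · simp [ih.2 rfl]
    · exact ι_mul_mem n x ih.1

theorem tensorTheta_bijective : Function.Bijective (tensorTheta t) := by
  constructor
  · rw [injective_iff_map_eq_zero]
    intro a
    obtain ⟨n, hn⟩ := exists_mem_tensorLE a
    induction n with
    | zero => intro h; rw [← (tensorTheta_sub_mem t 0 a hn).2 rfl, h]
    | succ n ih =>
      intro h
      have := (tensorTheta_sub_mem t _ a hn).1
      rw [h, zero_sub] at this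
      exact ih (by simpa using neg_mem this) h
  · intro a
    obtain ⟨n, hn⟩ := exists_mem_tensorLE a
    induction n generalizing a with
    | zero => exact ⟨a, (tensorTheta_sub_mem t 0 a hn).2 rfl⟩
    | succ n ih =>
      obtain ⟨b, hb⟩ := ih _ (tensorTheta_sub_mem t _ a hn).1
      exact ⟨a - b, by rw [map_sub, hb]; abel⟩

/-- The inverse of `θ`; it satisfies `θ⁻¹ (x A) = x θ⁻¹ A - θ⁻¹ (D_x A)`. -/
noncomputable def tensorThetaInv : Module.End k (TensorAlgebra k P) :=
  (LinearEquiv.ofBijective (tensorTheta t) (tensorTheta_bijective t)).symm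

@[simp] theorem tensorTheta_inv (a : TensorAlgebra k P) :
    tensorTheta t (tensorThetaInv t a) = a :=
  (LinearEquiv.ofBijective (tensorTheta t) (tensorTheta_bijective t)).apply_symm_apply a

@[simp] theorem tensorThetaInv_theta (a : TensorAlgebra k P) :
    tensorThetaInv t (tensorTheta t a) = a :=
  (LinearEquiv.ofBijective (tensorTheta t) (tensorTheta_bijective t)).symm_apply_apply a

theorem tensorThetaInv_ι_mul (x : P) (a : TensorAlgebra k P) :
    tensorThetaInv t (TensorAlgebra.ι k x * a) =
      TensorAlgebra.ι k x * tensorThetaInv t a - tensorThetaInv t (tensorDer (t x) a) := by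
  apply (tensorTheta_bijective t).1
  rw [map_sub, tensorTheta_ι_mul]
  simp

end TensorLevel

section Enveloping

variable (k P : Type*) [CommRing k] [LieRing P] [LieAlgebra k P] [PostLieAlgebra k P]

/-- The tensor-level map `T(P) → U(P, ⟦,⟧)` that induces `envInv`. -/
noncomputable def tensorJ : TensorAlgebra k P →ₗ[k] UniversalEnvelopingAlgebra k (Double k P) :=
  (TensorAlgebra.lift k (incl k (Double k P) ∘ₗ (toDouble k P).toLinearMap)).toLinearMap ∘ₗ
    tensorThetaInv (tri (k := k) (P := P))

variable {k P}

theorem tensorJ_ι_mul (x : P) (a : TensorAlgebra k P) :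
    tensorJ k P (TensorAlgebra.ι k x * a) = incl k (Double k P) (toDouble k P x) * tensorJ k P a -
      tensorJ k P (tensorDer (tri x) a) := by
  simp [tensorJ, tensorThetaInv_ι_mul]

theorem tensorDer_double (x y : P) (a : TensorAlgebra k P) :
    tensorDer (tri (k := k) x) (tensorDer (tri y) a) - tensorDer (tri y) (tensorDer (tri x) a) =
      tensorDer (tri (tri (k := k) x y)) a - tensorDer (tri (tri (k := k) y x)) a
        + tensorDer (tri ⁅x, y⁆) a := by
  rw [← tensorDer_comm (tri x) (tri y)
    (tri (tri (k := k) x y) + (-1 : k) • tri (tri (k := k) y x) + tri ⁅x, y⁆)]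
  · rw [tensorDer_add, tensorDer_add, tensorDer_smul]; module
  · intro z
    simp only [LinearMap.add_apply, LinearMap.smul_apply, lie_tri]; module

theorem tensorJ_rel_aux (x y : P) (B : TensorAlgebra k P) :
    tensorJ k P ((TensorAlgebra.ι k x * TensorAlgebra.ι k y -
      TensorAlgebra.ι k y * TensorAlgebra.ι k x - TensorAlgebra.ι k ⁅x, y⁆) * B) = 0 := by
  have h1 : incl k (Double k P) (toDouble k P x) * incl k (Double k P) (toDouble k P y) -
      incl k (Double k P) (toDouble k P y) * incl k (Double k P) (toDouble k P x) =
      incl k (Double k P) (toDouble k P (tri (k := k) x y)) -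
      incl k (Double k P) (toDouble k P (tri (k := k) y x)) +
      incl k (Double k P) (toDouble k P ⁅x, y⁆) := by
    rw [← incl_lie, double_lie, map_add, map_sub, map_add, map_sub]
  have h2 := congrArg (tensorJ k P) (tensorDer_double x y B)
  simp only [map_add, map_sub] at h2
  simp only [sub_mul, map_sub, mul_assoc, tensorJ_ι_mul, tensorDer_mul, tensorDer_ι, map_add,
    mul_sub]
  rw [sub_eq_iff_eq_add] at h1 h2
  simp only [← mul_assoc, h1, h2]
  noncomm_ring

theorem tensorJ_rel (n : ℕ) (b : TensorAlgebra k P) (hb : b ∈ tensorLE k P n) :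
    ∀ (x y : P) (B : TensorAlgebra k P),
    tensorJ k P (b * (TensorAlgebra.ι k x * TensorAlgebra.ι k y -
      TensorAlgebra.ι k y * TensorAlgebra.ι k x - TensorAlgebra.ι k ⁅x, y⁆) * B) = 0 := by
  induction n generalizing b with
  | zero =>
    intro x y B
    obtain ⟨r, rfl⟩ := Submodule.mem_one.1 (by simpa [tensorLE] using hb)
    rw [mul_assoc, ← Algebra.smul_def, map_smul, tensorJ_rel_aux, smul_zero]
  | succ n ih =>
    intro x y B
    rw [tensorLE, pow_succ'] at hb
    refine Submodule.mul_induction_on hb (fun m hm b hb => ?_) (fun a b ha hb => ?_)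
    · obtain ⟨c, hc, v, hv, rfl⟩ := Submodule.mem_sup.1 hm
      obtain ⟨r, rfl⟩ := Submodule.mem_one.1 hc
      obtain ⟨z, rfl⟩ := hv
      rw [add_mul, ← Algebra.smul_def, add_mul, add_mul, map_add, smul_mul_assoc, smul_mul_assoc,
        map_smul, ih b hb, smul_zero, zero_add, mul_assoc, mul_assoc, tensorJ_ι_mul,
        ← mul_assoc b, ih b hb, mul_zero, zero_sub, neg_eq_zero, tensorDer_mul, tensorDer_mul,
        add_mul, map_add, map_add, ih _ (tensorDer_mem _ _ _ hb), ih b hb, add_zero, zero_add]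
      have h1 := ih b hb (tri (k := k) z x) y B
      have h2 := ih b hb x (tri (k := k) z y) B
      have h3 := congrArg₂ (· + ·) h1 h2
      simp only [← map_add] at h3
      rw [add_zero] at h3
      rw [← h3]
      congr 1
      simp only [map_sub, tensorDer_mul, tensorDer_ι, tri_lie, map_add]
      noncomm_ring
    · rw [add_mul, add_mul, map_add, ha, hb, add_zero]

theorem tensorJ_eq_of_rel (a b : TensorAlgebra k P)
    (h : UniversalEnvelopingAlgebra.mkAlgHom k P a = UniversalEnvelopingAlgebra.mkAlgHom k P b) :
    tensorJ k P a = tensorJ k P b := by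
  have key : ∀ a b, RingConGen.Rel (UniversalEnvelopingAlgebra.Rel k P) a b →
      ∀ c d, tensorJ k P (c * a * d) = tensorJ k P (c * b * d) := by
    intro a b h
    induction h with
    | of _ _ h =>
      intro c d
      obtain ⟨x, y⟩ := h
      obtain ⟨n, hn⟩ := exists_mem_tensorLE c
      have := tensorJ_rel n c hn x y d
      rw [← sub_eq_zero, ← map_sub, ← sub_mul, ← mul_sub, ← neg_eq_zero, ← map_neg, ← neg_mul,
        ← mul_neg]
      convert this using 5
      abel
    | refl _ => intros; rfl
    | symm _ ih => intro c d; exact (ih c d).symm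
    | trans _ _ h1 h2 => intro c d; exact (h1 c d).trans (h2 c d)
    | add _ _ h1 h2 => intro c d; simp only [mul_add, add_mul, map_add, h1 c d, h2 c d]
    | mul _ _ h1 h2 =>
      rename_i w x y z _ _
      intro c d
      have e1 := h1 c (y * d)
      have e2 := h2 (c * x) d
      simp only [mul_assoc] at e1 e2 ⊢
      exact e1.trans e2
  have := key a b ((RingCon.eq _).1 h) 1 1
  simpa using this

variable (k P)

/-- The linear map `U(P, [,]) → U(P, ⟦,⟧)` induced by `tensorJ`. -/
noncomputable def envInv :
    UniversalEnvelopingAlgebra k P →ₗ[k] UniversalEnvelopingAlgebra k (Double k P) :=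
  (Submodule.liftQ (LinearMap.ker (UniversalEnvelopingAlgebra.mkAlgHom k P).toLinearMap)
    (tensorJ k P) (fun a ha => by
      have : tensorJ k P a = tensorJ k P 0 := tensorJ_eq_of_rel a 0 (by simpa using ha)
      simpa using this)) ∘ₗ
  ((UniversalEnvelopingAlgebra.mkAlgHom k P).toLinearMap.quotKerEquivOfSurjective
    mkAlgHom_surjective).symm.toLinearMap

variable {k P}

theorem envInv_mk (a : TensorAlgebra k P) :
    envInv k P (UniversalEnvelopingAlgebra.mkAlgHom k P a) = tensorJ k P a := by
  have : ((UniversalEnvelopingAlgebra.mkAlgHom k P).toLinearMap.quotKerEquivOfSurjective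
      mkAlgHom_surjective).symm (UniversalEnvelopingAlgebra.mkAlgHom k P a) =
      Submodule.Quotient.mk a := by
    rw [LinearEquiv.symm_apply_eq]; rfl
  simp only [envInv, LinearMap.comp_apply, LinearEquiv.coe_coe]
  rw [this]; rfl

/-- The derivation `x ▷ ·` of the enveloping algebra `U(P)`. -/
noncomputable def triDer (x : P) : Module.End k (UniversalEnvelopingAlgebra k P) :=
  envDer (tri x) (tri_lie x)

theorem triDer_mk (x : P) (a : TensorAlgebra k P) :
    triDer x (UniversalEnvelopingAlgebra.mkAlgHom k P a) =
      UniversalEnvelopingAlgebra.mkAlgHom k P (tensorDer (tri (k := k) x) a) := by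
  induction a using TensorAlgebra.induction with
  | algebraMap r => simp [triDer]
  | ι x => simp [triDer, mkAlgHom_ι]
  | mul a b h1 h2 =>
    simp only [triDer] at h1 h2
    simp only [tensorDer_mul, map_mul, map_add, triDer, envDer_mul, h1, h2]
  | add a b h1 h2 => simp only [map_add, h1, h2]

variable (k P)

/-- The linear map `x ↦ (B ↦ x • B + x ▷ B)`. -/
noncomputable def starOp : P →ₗ[k] Module.End k (UniversalEnvelopingAlgebra k P) where
  toFun x := LinearMap.mulLeft k (incl k P x) + triDer x
  map_add' x y := by
    ext1 a; obtain ⟨a, rfl⟩ := mkAlgHom_surjective a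
    simp [triDer_mk, add_mul, tensorDer_add]; abel
  map_smul' r x := by
    ext1 a; obtain ⟨a, rfl⟩ := mkAlgHom_surjective a
    simp [triDer_mk, tensorDer_smul]

variable {k P}

theorem starOp_apply (x : P) (a : UniversalEnvelopingAlgebra k P) :
    starOp k P x a = incl k P x * a + triDer x a := rfl

theorem starOp_lie (x y : Double k P) :
    (starOp k P ∘ₗ (toDouble k P).symm.toLinearMap) ⁅x, y⁆ =
      (starOp k P ∘ₗ (toDouble k P).symm.toLinearMap) x *
        (starOp k P ∘ₗ (toDouble k P).symm.toLinearMap) y -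
      (starOp k P ∘ₗ (toDouble k P).symm.toLinearMap) y *
        (starOp k P ∘ₗ (toDouble k P).symm.toLinearMap) x := by
  obtain ⟨x, rfl⟩ := (toDouble k P).surjective x
  obtain ⟨y, rfl⟩ := (toDouble k P).surjective y
  ext1 a
  obtain ⟨a, rfl⟩ := mkAlgHom_surjective a
  have h := congrArg (UniversalEnvelopingAlgebra.mkAlgHom k P) (tensorDer_double x y a)
  rw [double_lie]
  simp only [map_add, map_sub, ← triDer_mk] at h
  simp only [LinearMap.comp_apply, LinearEquiv.coe_coe, LinearEquiv.symm_apply_apply,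
    LinearMap.sub_apply, Module.End.mul_apply, map_add, map_sub, LinearMap.add_apply,
    starOp_apply, incl_lie]
  rw [sub_eq_iff_eq_add] at h
  rw [h]
  simp only [triDer, envDer_mul, envDer_incl]
  noncomm_ring

variable (k P)

/-- The action of `U(P, ⟦,⟧)` on `U(P, [,])` in which `x ∈ P` acts by `B ↦ x • B + x ▷ B`. -/
noncomputable def starAction :
    UniversalEnvelopingAlgebra k (Double k P) →ₐ[k] Module.End k (UniversalEnvelopingAlgebra k P) :=
  envLift (starOp k P ∘ₗ (toDouble k P).symm.toLinearMap) starOp_lie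

/-- The linear map `U(P, ⟦,⟧) → U(P, [,])`, `a ↦ a · 1`. -/
noncomputable def envTheta :
    UniversalEnvelopingAlgebra k (Double k P) →ₗ[k] UniversalEnvelopingAlgebra k P :=
  LinearMap.applyₗ (1 : UniversalEnvelopingAlgebra k P) ∘ₗ (starAction k P).toLinearMap

variable {k P}

theorem envTheta_mul (x : P) (a : UniversalEnvelopingAlgebra k (Double k P)) :
    envTheta k P (incl k (Double k P) (toDouble k P x) * a) =
      incl k P x * envTheta k P a + triDer x (envTheta k P a) := by
  simp [envTheta, starAction, starOp_apply]

theorem tensorLift_surjective : Function.Surjective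
    (TensorAlgebra.lift k (incl k (Double k P) ∘ₗ (toDouble k P).toLinearMap)) := by
  intro a
  induction a using env_induction with
  | h0 r => exact ⟨algebraMap k _ r, by simp⟩
  | hι x => exact ⟨TensorAlgebra.ι k ((toDouble k P).symm x), by simp⟩
  | hm a b h1 h2 =>
    obtain ⟨a, rfl⟩ := h1
    obtain ⟨b, rfl⟩ := h2
    exact ⟨a * b, map_mul _ _ _⟩
  | ha a b h1 h2 =>
    obtain ⟨a, rfl⟩ := h1
    obtain ⟨b, rfl⟩ := h2
    exact ⟨a + b, map_add _ _ _⟩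

theorem envTheta_lift (a : TensorAlgebra k P) :
    envTheta k P (TensorAlgebra.lift k (incl k (Double k P) ∘ₗ (toDouble k P).toLinearMap) a) =
      UniversalEnvelopingAlgebra.mkAlgHom k P (tensorTheta (tri (k := k) (P := P)) a) := by
  obtain ⟨n, hn⟩ := exists_mem_tensorLE a
  refine tensorLE_induction (C := fun _ a => envTheta k P (TensorAlgebra.lift k
      (incl k (Double k P) ∘ₗ (toDouble k P).toLinearMap) a) =
      UniversalEnvelopingAlgebra.mkAlgHom k P (tensorTheta (tri (k := k) (P := P)) a))
    (fun r => ?_) (fun n a b h1 h2 => ?_) (fun n r a h ih => ?_) (fun n x a h ih => ?_) n a hn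
  · rw [tensorTheta_algebraMap, AlgHom.commutes, AlgHom.commutes]
    simp [envTheta, Algebra.algebraMap_eq_smul_one]
  · simp only [map_add, h1, h2]
  · simp only [map_smul, ih]
  · rw [map_mul, TensorAlgebra.lift_ι_apply, tensorTheta_ι_mul, map_add,
      map_mul (UniversalEnvelopingAlgebra.mkAlgHom k P), ← triDer_mk, ← ih]
    exact envTheta_mul _ _

variable (k P)

/-- The canonical identification of the enveloping algebra of `(P, ⟦,⟧)` with that of `(P, [,])`,
as vector spaces: it maps `1` to `1` and `x a` to `x • θ a + x ▷ θ a` for `x` in `P`. -/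
noncomputable def envEquiv :
    UniversalEnvelopingAlgebra k (Double k P) ≃ₗ[k] UniversalEnvelopingAlgebra k P :=
  LinearEquiv.ofLinearMap (envTheta k P) (envInv k P)
    (by
      ext1 A
      obtain ⟨A, rfl⟩ := mkAlgHom_surjective A
      simp only [LinearMap.comp_apply, envInv_mk, tensorJ, AlgHom.toLinearMap_apply, envTheta_lift,
        tensorTheta_inv, LinearMap.id_apply])
    (by
      ext1 a
      obtain ⟨a, rfl⟩ := tensorLift_surjective a
      simp only [LinearMap.comp_apply, envInv_mk, tensorJ, AlgHom.toLinearMap_apply, envTheta_lift,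
        tensorThetaInv_theta, LinearMap.id_apply])

end Enveloping

section Products

variable (k P : Type*) [CommRing k] [LieRing P] [LieAlgebra k P] [PostLieAlgebra k P]

/-- The product `A * B` on `U(P)`: the product of the enveloping algebra of `(P, ⟦,⟧)`, transported
to `U(P)` by the canonical identification. -/
noncomputable def starProd (A B : UniversalEnvelopingAlgebra k P) : UniversalEnvelopingAlgebra k P :=
  envEquiv k P ((envEquiv k P).symm A * (envEquiv k P).symm B)

/-- The Lie algebra `(P, ⟦,⟧)` acts on `P` by `▷`; this is the induced action of its
enveloping algebra. -/
noncomputable def doubleAction :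
    UniversalEnvelopingAlgebra k (Double k P) →ₐ[k] Module.End k P :=
  envLift (tri ∘ₗ (toDouble k P).symm.toLinearMap) (by
    intro x y
    obtain ⟨x, rfl⟩ := (toDouble k P).surjective x
    obtain ⟨y, rfl⟩ := (toDouble k P).surjective y
    ext1 z
    rw [double_lie]
    simp [lie_tri]
    abel)

/-- The action `A ▷ y` of `U(P)` on `P`, as a linear map in `A` and in `y`. -/
noncomputable def triAction : UniversalEnvelopingAlgebra k P →ₗ[k] Module.End k P :=
  (doubleAction k P).toLinearMap ∘ₗ (envEquiv k P).symm.toLinearMap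

variable {k P}

@[simp] theorem envEquiv_one : envEquiv k P 1 = 1 := by
  simp [envEquiv, envTheta]

@[simp] theorem envEquiv_symm_one : (envEquiv k P).symm 1 = 1 := by
  rw [LinearEquiv.symm_apply_eq, envEquiv_one]

theorem envEquiv_mul (x : P) (a : UniversalEnvelopingAlgebra k (Double k P)) :
    envEquiv k P (incl k (Double k P) (toDouble k P x) * a) =
      incl k P x * envEquiv k P a + triDer x (envEquiv k P a) := envTheta_mul x a

theorem envEquiv_symm_mul (x : P) (A : UniversalEnvelopingAlgebra k P) :
    (envEquiv k P).symm (incl k P x * A) =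
      incl k (Double k P) (toDouble k P x) * (envEquiv k P).symm A -
        (envEquiv k P).symm (triDer x A) := by
  rw [LinearEquiv.symm_apply_eq, map_sub, envEquiv_mul]
  simp

theorem triDer_one (x : P) : triDer (k := k) x 1 = 0 := by
  have := envDer_algebraMap (k := k) (P := P) (tri x) (tri_lie x) 1
  rwa [map_one] at this

theorem envEquiv_symm_incl (x : P) :
    (envEquiv k P).symm (incl k P x) = incl k (Double k P) (toDouble k P x) := by
  have := envEquiv_symm_mul x (1 : UniversalEnvelopingAlgebra k P)
  simpa [triDer_one] using this

theorem star_one (A : UniversalEnvelopingAlgebra k P) : starProd k P A 1 = A := by simp [starProd]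

theorem one_star (A : UniversalEnvelopingAlgebra k P) : starProd k P 1 A = A := by simp [starProd]

/-- `x * B = x • B + x ▷ B` for `x` in `P`. -/
theorem star_incl (x : P) (B : UniversalEnvelopingAlgebra k P) :
    starProd k P (incl k P x) B = incl k P x * B + triDer x B := by
  simp [starProd, envEquiv_symm_incl, envEquiv_mul]

theorem star_assoc (A B C : UniversalEnvelopingAlgebra k P) :
    starProd k P (starProd k P A B) C = starProd k P A (starProd k P B C) := by
  simp [starProd, mul_assoc]

theorem triAction_one (y : P) : triAction k P 1 y = y := by simp [triAction]

theorem triAction_incl (x y : P) : triAction k P (incl k P x) y = tri (k := k) x y := by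
  simp [triAction, envEquiv_symm_incl, doubleAction]

/-- `(x • A) ▷ y = x ▷ (A ▷ y) - (x ▷ A) ▷ y` for `x`, `y` in `P`. -/
theorem triAction_incl_mul (x y : P) (A : UniversalEnvelopingAlgebra k P) :
    triAction k P (incl k P x * A) y =
      tri (k := k) x (triAction k P A y) - triAction k P (triDer x A) y := by
  simp [triAction, envEquiv_symm_mul, doubleAction]

/-- `(A * B) ▷ y = A ▷ (B ▷ y)`. -/
theorem triAction_star (A B : UniversalEnvelopingAlgebra k P) (y : P) :
    triAction k P (starProd k P A B) y = triAction k P A (triAction k P B y) := by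
  simp [triAction, starProd]

end Products

section Words

variable {k P A : Type*} [CommRing k] [AddCommGroup P] [Module k P] [Ring A] [Algebra k A]

/-- A list of weighted elements `(i, x)` in which every `x` lies in `fil i`. -/
def IsWord (fil : ℕ → Submodule k P) (l : List (ℕ × P)) : Prop := ∀ u ∈ l, u.2 ∈ fil u.1

/-- The span of all products `j x₁ ⋯ j xₙ` with `n ≥ 0`, `x_r ∈ fil i_r` and `i₁ + ⋯ + iₙ ≥ p`. -/
noncomputable def wordSpan (fil : ℕ → Submodule k P) (j : P →ₗ[k] A) (p : ℕ) : Submodule k A :=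
  Submodule.span k {a | ∃ l : List (ℕ × P), IsWord fil l ∧ p ≤ (l.map Prod.fst).sum ∧
    a = (l.map fun u => j u.2).prod}

variable {fil : ℕ → Submodule k P} {j : P →ₗ[k] A}

theorem word_mem {l : List (ℕ × P)} (hl : IsWord fil l) {p : ℕ} (hp : p ≤ (l.map Prod.fst).sum) :
    (l.map fun u => j u.2).prod ∈ wordSpan fil j p :=
  Submodule.subset_span ⟨l, hl, hp, rfl⟩

theorem wordSpan_anti {p q : ℕ} (h : p ≤ q) : wordSpan fil j q ≤ wordSpan fil j p := by
  refine Submodule.span_mono ?_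
  rintro _ ⟨l, hl, hq, rfl⟩
  exact ⟨l, hl, h.trans hq, rfl⟩

theorem wordSpan_mul {p q : ℕ} {a b : A} (ha : a ∈ wordSpan fil j p) (hb : b ∈ wordSpan fil j q) :
    a * b ∈ wordSpan fil j (p + q) := by
  have h := Submodule.mul_mem_mul ha hb
  rw [wordSpan, wordSpan, Submodule.span_mul_span] at h
  refine Submodule.span_mono ?_ h
  rintro _ ⟨_, ⟨l, hl, hp, rfl⟩, _, ⟨m, hm, hq, rfl⟩, rfl⟩
  refine ⟨l ++ m, fun u hu => ?_, by simpa using add_le_add hp hq, by simp⟩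
  rcases List.mem_append.1 hu with h | h
  exacts [hl u h, hm u h]

theorem letter_mem {i : ℕ} {x : P} (hx : x ∈ fil i) : j x ∈ wordSpan fil j i := by
  have := word_mem (j := j) (l := [(i, x)]) (fil := fil) (p := i) (by simpa [IsWord] using hx)
    (by simp)
  simpa using this

theorem one_mem_wordSpan : (1 : A) ∈ wordSpan fil j 0 := by
  simpa using word_mem (j := j) (l := []) (fil := fil) (p := 0) (by simp [IsWord]) (by simp)

end Words

section Filtration

variable (k P : Type*) [CommRing k] [LieRing P] [LieAlgebra k P] [PostLieAlgebra k P]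

/-- A decreasing filtration `P = P¹ ⊇ P² ⊇ ⋯` (with `P⁰ = P` added) that is compatible with the
bracket and with `▷`, and for which `P` is complete: the map from `P` to the inverse limit of the
quotients `P / Pᵖ` is injective (`separated`) and surjective (`complete`). -/
structure CompleteFiltration where
  fil : ℕ → Submodule k P
  anti : Antitone fil
  fil_one : fil 1 = ⊤
  lie_mem : ∀ p q x y, x ∈ fil p → y ∈ fil q → ⁅x, y⁆ ∈ fil (p + q)
  tri_mem : ∀ p q x y, x ∈ fil p → y ∈ fil q → tri (k := k) x y ∈ fil (p + q)
  separated : ∀ x, (∀ p, x ∈ fil p) → x = 0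
  complete : ∀ s : ℕ → P, (∀ p, s (p + 1) - s p ∈ fil p) → ∃ z, ∀ p, z - s p ∈ fil p

end Filtration

namespace CompleteFiltration

section Estimates

variable {k P : Type*} [CommRing k] [LieRing P] [LieAlgebra k P] [PostLieAlgebra k P]
variable (F : CompleteFiltration k P)

theorem mem_fil_zero (x : P) : x ∈ F.fil 0 :=
  F.anti (Nat.zero_le 1) (by rw [F.fil_one]; trivial)

/-- The filtration of `U(P)`: `Fᵖ` is spanned by the products `x₁ • ⋯ • xₙ` with `x_r ∈ P^{i_r}` and
`i₁ + ⋯ + iₙ ≥ p`. -/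
noncomputable def envFil (p : ℕ) : Submodule k (UniversalEnvelopingAlgebra k P) := wordSpan F.fil (incl k P) p

theorem mem_envFil_zero (a : UniversalEnvelopingAlgebra k P) : a ∈ F.envFil 0 := by
  induction a using env_induction with
  | h0 r => rw [Algebra.algebraMap_eq_smul_one]; exact Submodule.smul_mem _ _ one_mem_wordSpan
  | hι x => exact letter_mem (j := incl k P) (F.mem_fil_zero x)
  | hm a b h1 h2 =>
    have h := wordSpan_mul (j := incl k P) h1 h2
    rwa [add_zero] at h
  | ha a b h1 h2 => exact add_mem h1 h2

/-- The corresponding filtration of the enveloping algebra of `(P, ⟦,⟧)`. -/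
noncomputable def doubleFil (p : ℕ) : Submodule k (UniversalEnvelopingAlgebra k (Double k P)) :=
  wordSpan F.fil (incl k (Double k P) ∘ₗ (toDouble k P).toLinearMap) p

theorem triDer_word {i : ℕ} {x : P} (hx : x ∈ F.fil i) (l : List (ℕ × P)) (hl : IsWord F.fil l) :
    triDer (k := k) x (l.map fun u => incl k P u.2).prod ∈ Submodule.span k
      {a | ∃ m : List (ℕ × P), IsWord F.fil m ∧ m.length = l.length ∧
        (m.map Prod.fst).sum = i + (l.map Prod.fst).sum ∧
        a = (m.map fun u => incl k P u.2).prod} := by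
  induction l with
  | nil => simp [triDer_one]
  | cons u l ih =>
    have hu : u.2 ∈ F.fil u.1 := hl u (by simp)
    have hl' : IsWord F.fil l := fun v hv => hl v (by simp [hv])
    have hD : triDer (k := k) x (incl k P u.2 * (l.map fun u => incl k P u.2).prod) =
        incl k P (tri (k := k) x u.2) * (l.map fun u => incl k P u.2).prod +
        incl k P u.2 * triDer (k := k) x (l.map fun u => incl k P u.2).prod := by
      simp [triDer, envDer_mul]
    simp only [List.map_cons, List.prod_cons, List.sum_cons, List.length_cons, hD]
    refine add_mem (Submodule.subset_span ⟨(i + u.1, tri (k := k) x u.2) :: l, ?_, by simp,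
      by simp [add_assoc], by simp⟩) ?_
    · intro v hv
      rcases List.mem_cons.1 hv with rfl | hv
      exacts [F.tri_mem _ _ _ _ hx hu, hl' v hv]
    · have h := Submodule.mem_map_of_mem (f := LinearMap.mulLeft k (incl k P u.2)) (ih hl')
      rw [Submodule.map_span] at h
      refine Submodule.span_mono ?_ h
      rintro _ ⟨_, ⟨m, hm, h1, h2, rfl⟩, rfl⟩
      refine ⟨u :: m, fun v hv => ?_, by simp [h1], by simp [h2]; omega, by simp⟩
      rcases List.mem_cons.1 hv with rfl | hv
      exacts [hu, hm v hv]

theorem triDer_mem {i p : ℕ} {x : P} (hx : x ∈ F.fil i) {a : UniversalEnvelopingAlgebra k P}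
    (ha : a ∈ F.envFil p) : triDer x a ∈ F.envFil (i + p) := by
  refine Submodule.span_induction ?_ (by simp) (fun a b _ _ h1 h2 => ?_) (fun r a _ h => ?_) ha
  · rintro _ ⟨l, hl, hp, rfl⟩
    refine Submodule.span_mono ?_ (F.triDer_word hx l hl)
    rintro _ ⟨m, hm, -, h2, rfl⟩
    exact ⟨m, hm, by omega, rfl⟩
  · rw [map_add]; exact add_mem h1 h2
  · rw [map_smul]; exact Submodule.smul_mem _ _ h

theorem envEquiv_mem {p : ℕ} {a : UniversalEnvelopingAlgebra k (Double k P)}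
    (ha : a ∈ F.doubleFil p) : envEquiv k P a ∈ F.envFil p := by
  refine Submodule.span_induction ?_ (by simp) (fun a b _ _ h1 h2 => ?_) (fun r a _ h => ?_) ha
  · rintro _ ⟨l, hl, hp, rfl⟩
    refine wordSpan_anti hp ?_
    clear hp
    induction l with
    | nil => simpa using one_mem_wordSpan
    | cons u l ih =>
      have hu : u.2 ∈ F.fil u.1 := hl u (by simp)
      have h := ih (fun v hv => hl v (by simp [hv]))
      simp only [List.map_cons, List.prod_cons, List.sum_cons, LinearMap.comp_apply,
        LinearEquiv.coe_coe, envEquiv_mul] at h ⊢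
      exact add_mem (wordSpan_mul (letter_mem hu) h) (F.triDer_mem hu h)
  · rw [map_add]; exact add_mem h1 h2
  · rw [map_smul]; exact Submodule.smul_mem _ _ h

theorem envEquiv_symm_mem {p : ℕ} {a : UniversalEnvelopingAlgebra k P}
    (ha : a ∈ F.envFil p) : (envEquiv k P).symm a ∈ F.doubleFil p := by
  refine Submodule.span_induction ?_ (by simp) (fun a b _ _ h1 h2 => ?_) (fun r a _ h => ?_) ha
  · rintro _ ⟨l, hl, hp, rfl⟩
    refine wordSpan_anti hp ?_
    clear hp
    induction hn : l.length generalizing l with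
    | zero =>
      obtain rfl := List.length_eq_zero_iff.1 hn
      simpa using one_mem_wordSpan
    | succ n ih =>
      obtain ⟨u, l, rfl⟩ := List.exists_cons_of_length_eq_add_one hn
      have hu : u.2 ∈ F.fil u.1 := hl u (by simp)
      have hl' : IsWord F.fil l := fun v hv => hl v (by simp [hv])
      have hn' : l.length = n := by simpa using hn
      simp only [List.map_cons, List.prod_cons, List.sum_cons, envEquiv_symm_mul]
      refine sub_mem (wordSpan_mul (letter_mem (j := incl k (Double k P) ∘ₗ
        (toDouble k P).toLinearMap) hu) (ih l hl' hn')) ?_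
      refine Submodule.span_induction ?_ (by simp) (fun a b _ _ h1 h2 => ?_) (fun r a _ h => ?_)
        (F.triDer_word hu l hl')
      · rintro _ ⟨m, hm, h1, h2, rfl⟩
        rw [← h2]; exact ih m hm (h1.trans hn')
      · rw [map_add]; exact add_mem h1 h2
      · rw [map_smul]; exact Submodule.smul_mem _ _ h
  · rw [map_add]; exact add_mem h1 h2
  · rw [map_smul]; exact Submodule.smul_mem _ _ h

theorem star_mem {p q : ℕ} {a b : UniversalEnvelopingAlgebra k P} (ha : a ∈ F.envFil p)
    (hb : b ∈ F.envFil q) : starProd k P a b ∈ F.envFil (p + q) :=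
  F.envEquiv_mem (wordSpan_mul (F.envEquiv_symm_mem ha) (F.envEquiv_symm_mem hb))

theorem doubleAction_mem {p q : ℕ} {a : UniversalEnvelopingAlgebra k (Double k P)}
    (ha : a ∈ F.doubleFil p) {y : P} (hy : y ∈ F.fil q) :
    doubleAction k P a y ∈ F.fil (p + q) := by
  refine Submodule.span_induction ?_ (by simp) (fun a b _ _ h1 h2 => ?_) (fun r a _ h => ?_) ha
  · rintro _ ⟨l, hl, hp, rfl⟩
    refine F.anti (Nat.add_le_add_right hp q) ?_
    clear hp
    induction l with
    | nil => simpa using hy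
    | cons u l ih =>
      have hu : u.2 ∈ F.fil u.1 := hl u (by simp)
      have h := ih (fun v hv => hl v (by simp [hv]))
      have h2 := F.tri_mem _ _ _ _ hu h
      rw [← add_assoc] at h2
      simpa [doubleAction] using h2
  · rw [map_add]; exact add_mem h1 h2
  · rw [map_smul]; exact Submodule.smul_mem _ _ h

theorem triAction_mem {p q : ℕ} {a : UniversalEnvelopingAlgebra k P} (ha : a ∈ F.envFil p)
    {y : P} (hy : y ∈ F.fil q) : triAction k P a y ∈ F.fil (p + q) :=
  F.doubleAction_mem (F.envEquiv_symm_mem ha) hy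

end Estimates

end CompleteFiltration
namespace CompleteFiltration

section Completion

variable {k P : Type*} [CommRing k] [LieRing P] [LieAlgebra k P] [PostLieAlgebra k P]
variable (F : CompleteFiltration k P)

/-- The two-sided ideal `Fᵖ` of `(U(P), •)`. -/
noncomputable def envIdeal (p : ℕ) : Ideal (UniversalEnvelopingAlgebra k P) where
  __ := F.envFil p
  smul_mem' a b hb := by
    have h := wordSpan_mul (j := incl k P) (F.mem_envFil_zero a) hb
    rwa [zero_add] at h

theorem mem_envIdeal {p : ℕ} {a : UniversalEnvelopingAlgebra k P} :
    a ∈ F.envIdeal p ↔ a ∈ F.envFil p := Iff.rfl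

instance (p : ℕ) : (F.envIdeal p).IsTwoSided where
  mul_mem_of_left {a} b ha := by
    have h := wordSpan_mul (j := incl k P) ha (F.mem_envFil_zero b)
    rwa [add_zero] at h

theorem envIdeal_anti {p q : ℕ} (h : p ≤ q) : F.envIdeal q ≤ F.envIdeal p := wordSpan_anti h

/-- The completed enveloping algebra as a subalgebra of `∏ U(P)/Fᵖ`: the compatible families. -/
noncomputable def completionSubalgebra :
    Subalgebra k ((p : ℕ) → UniversalEnvelopingAlgebra k P ⧸ F.envIdeal p) where
  carrier := {s | ∀ p, Ideal.Quotient.factorₐ k (F.envIdeal_anti (Nat.le_succ p)) (s (p + 1)) = s p}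
  mul_mem' {a b} ha hb p := by simp only [Pi.mul_apply, map_mul, ha p, hb p]
  add_mem' {a b} ha hb p := by simp only [Pi.add_apply, map_add, ha p, hb p]
  algebraMap_mem' r p := by simp only [Pi.algebraMap_apply, AlgHom.commutes]

/-- The completed enveloping algebra `Û(P)`, the inverse limit of the algebras `U(P)/Fᵖ`; its ring
multiplication is the completed product `•`. -/
abbrev Completion : Type _ := F.completionSubalgebra

/-- The canonical map `U(P) → Û(P)`. -/
noncomputable def toCompletion : UniversalEnvelopingAlgebra k P →ₐ[k] F.Completion :=
  AlgHom.codRestrict (AlgHom.pi fun p => Ideal.Quotient.mkₐ k (F.envIdeal p))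
    F.completionSubalgebra (fun _ _ => rfl)

/-- The canonical map `P → Û(P)`. -/
noncomputable def of : P →ₗ[k] F.Completion := F.toCompletion.toLinearMap ∘ₗ incl k P

theorem exists_rep (s : F.Completion) (p : ℕ) :
    ∃ a : UniversalEnvelopingAlgebra k P, Ideal.Quotient.mk (F.envIdeal p) a = s.1 p :=
  Ideal.Quotient.mk_surjective _

theorem rep_eq (s : F.Completion) {p : ℕ} {a : UniversalEnvelopingAlgebra k P}
    (h : Ideal.Quotient.mk (F.envIdeal (p + 1)) a = s.1 (p + 1)) :
    Ideal.Quotient.mk (F.envIdeal p) a = s.1 p := by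
  rw [← s.2 p, ← h]; rfl

theorem rep_eq_le (s : F.Completion) {p q : ℕ} (hpq : p ≤ q) {a : UniversalEnvelopingAlgebra k P}
    (h : Ideal.Quotient.mk (F.envIdeal q) a = s.1 q) :
    Ideal.Quotient.mk (F.envIdeal p) a = s.1 p := by
  induction q, hpq using Nat.le_induction with
  | base => exact h
  | succ q _ ih => exact ih (F.rep_eq s h)

/-- The product `*` on the quotient `U(P)/Fᵖ`. -/
noncomputable def starQuot (p : ℕ) (a b : UniversalEnvelopingAlgebra k P ⧸ F.envIdeal p) :
    UniversalEnvelopingAlgebra k P ⧸ F.envIdeal p :=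
  Quotient.liftOn₂' a b (fun a b => Ideal.Quotient.mk (F.envIdeal p) (starProd k P a b)) (by
    intro a₁ b₁ a₂ b₂ ha hb
    replace ha : a₁ - a₂ ∈ F.envFil p := (Submodule.quotientRel_def _).1 ha
    replace hb : b₁ - b₂ ∈ F.envFil p := (Submodule.quotientRel_def _).1 hb
    refine Ideal.Quotient.eq.2 (F.mem_envIdeal.2 ?_)
    have e : starProd k P a₁ b₁ - starProd k P a₂ b₂ =
        starProd k P (a₁ - a₂) b₁ + starProd k P a₂ (b₁ - b₂) := by
      simp [starProd, sub_mul, mul_sub]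
    rw [e]
    have h1 := F.star_mem ha (F.mem_envFil_zero b₁)
    have h2 := F.star_mem (F.mem_envFil_zero a₂) hb
    rw [add_zero] at h1
    rw [zero_add] at h2
    exact add_mem h1 h2)

theorem starQuot_mk (p : ℕ) (a b : UniversalEnvelopingAlgebra k P) :
    F.starQuot p (Ideal.Quotient.mk _ a) (Ideal.Quotient.mk _ b) =
      Ideal.Quotient.mk (F.envIdeal p) (starProd k P a b) := rfl

/-- The completed product `*` on `Û(P)`. -/
noncomputable def star (a b : F.Completion) : F.Completion :=
  ⟨fun p => F.starQuot p (a.1 p) (b.1 p), fun p => by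
    obtain ⟨x, hx⟩ := F.exists_rep a (p + 1)
    obtain ⟨y, hy⟩ := F.exists_rep b (p + 1)
    dsimp only
    rw [← hx, ← hy, ← F.rep_eq a hx, ← F.rep_eq b hy]
    rfl⟩

theorem exists_act (a : F.Completion) (y : P) : ∃ z : P, ∀ (p : ℕ)
    (A : UniversalEnvelopingAlgebra k P), Ideal.Quotient.mk (F.envIdeal p) A = a.1 p →
      z - triAction k P A y ∈ F.fil p := by
  have key : ∀ p (A B : UniversalEnvelopingAlgebra k P),
      Ideal.Quotient.mk (F.envIdeal p) A = a.1 p → Ideal.Quotient.mk (F.envIdeal p) B = a.1 p →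
      triAction k P A y - triAction k P B y ∈ F.fil p := by
    intro p A B hA hB
    have h : A - B ∈ F.envFil p := Ideal.Quotient.eq.1 (hA.trans hB.symm)
    have h2 := F.triAction_mem h (F.mem_fil_zero y)
    rwa [map_sub, LinearMap.sub_apply] at h2
  choose A hA using F.exists_rep a
  obtain ⟨z, hz⟩ := F.complete (fun p => triAction k P (A p) y)
    (fun p => key p _ _ (F.rep_eq a (hA (p + 1))) (hA p))
  refine ⟨z, fun p B hB => ?_⟩
  have := add_mem (hz p) (key p _ _ (hA p) hB)
  simpa using this

/-- The action `a ▷ y` of `Û(P)` on the complete space `P`: the element of `P` that is congruent to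
`A ▷ y` modulo `Pᵖ` whenever `A` in `U(P)` represents `a` modulo `Fᵖ`. -/
noncomputable def act (a : F.Completion) (y : P) : P := (F.exists_act a y).choose

theorem act_spec (a : F.Completion) (y : P) {p : ℕ} {A : UniversalEnvelopingAlgebra k P}
    (h : Ideal.Quotient.mk (F.envIdeal p) A = a.1 p) :
    F.act a y - triAction k P A y ∈ F.fil p := (F.exists_act a y).choose_spec p A h

/-- The augmentation ideal of `Û(P)`: the kernel of `Û(P) → U(P)/F¹`. -/
noncomputable def augmentation : Submodule k F.Completion :=
  LinearMap.ker ((LinearMap.proj (R := k) 1) ∘ₗ F.completionSubalgebra.val.toLinearMap)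

theorem mem_augmentation {s : F.Completion} : s ∈ F.augmentation ↔ s.1 1 = 0 := Iff.rfl

theorem of_mem (x : P) : F.of x ∈ F.augmentation := by
  refine F.mem_augmentation.2 (Ideal.Quotient.eq_zero_iff_mem.2 (F.mem_envIdeal.2 ?_))
  exact letter_mem (j := incl k P) (by rw [F.fil_one]; trivial)

theorem pow_mem_envFil {a : UniversalEnvelopingAlgebra k P} (h : a ∈ F.envFil 1) (n : ℕ) :
    a ^ n ∈ F.envFil n := by
  induction n with
  | zero => exact F.mem_envFil_zero _
  | succ n ih => rw [pow_succ]; exact wordSpan_mul (j := incl k P) ih h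

theorem pow_eq_zero {s : F.Completion} (hs : s ∈ F.augmentation) (p : ℕ) : (s.1 p) ^ p = 0 := by
  obtain ⟨a, ha⟩ := F.exists_rep s p
  rw [← ha, ← map_pow, Ideal.Quotient.eq_zero_iff_mem, F.mem_envIdeal]
  rcases p with _ | p
  · exact F.mem_envFil_zero _
  · refine F.pow_mem_envFil ?_ _
    have := F.rep_eq_le s (Nat.le_add_left 1 p) ha
    rw [F.mem_augmentation.1 hs] at this
    exact Ideal.Quotient.eq_zero_iff_mem.1 this

/-- The sum of the power series `∑ cₙ sⁿ` at an element `s` of the augmentation ideal of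
`(Û(P), •)`; as `sⁿ` vanishes in `U(P)/Fᵖ` for `n ≥ p`, its component there is `∑_{n < p} cₙ sⁿ`. -/
noncomputable def series (c : ℕ → k) (s : F.Completion) (hs : s ∈ F.augmentation) : F.Completion :=
  ⟨fun p => ∑ n ∈ Finset.range p, c n • (s.1 p) ^ n, fun p => by
    rw [map_sum]
    simp only [map_smul, map_pow, s.2 p]
    rw [Finset.sum_range_succ, F.pow_eq_zero hs, smul_zero, add_zero]⟩

theorem series_one (c : ℕ → k) (s : F.Completion) (hs : s ∈ F.augmentation) :
    (F.series c s hs).1 1 = c 0 • 1 := by simp [series]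

end Completion

section Flows

variable {k P : Type*} [Field k] [LieRing P] [LieAlgebra k P] [PostLieAlgebra k P]
variable (F : CompleteFiltration k P)

/-- `exp•(x) = 1 + x + x²/2! + ⋯` in `Û(P)`, for `x` in `P`, with powers for the product `•`. -/
noncomputable def exp (x : P) : F.Completion :=
  F.series (fun n => ((n.factorial : k))⁻¹) (F.of x) (F.of_mem x)

/-- `log•(g) = s - s²/2 + s³/3 - ⋯` for `g = 1 + s` with `s` in the augmentation ideal. -/
noncomputable def log (g : F.Completion) (hg : g - 1 ∈ F.augmentation) : F.Completion :=
  F.series (fun n => if n = 0 then 0 else (-1) ^ (n + 1) / (n : k)) (g - 1) hg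

/-- The principal part of `g`: the element of `P` whose image in `Û(P)` is `log•(g)`. -/
noncomputable def principalPart (g : F.Completion) (hg : g - 1 ∈ F.augmentation) : P :=
  Classical.epsilon fun z => F.of z = F.log g hg

theorem exp_one (x : P) : (F.exp x).1 1 = 1 := by simp [exp, series_one]

theorem mul_exp_mem (x y : P) : F.exp x * F.exp y - 1 ∈ F.augmentation := by
  rw [mem_augmentation]
  have : (F.exp x * F.exp y - 1).1 1 = (F.exp x).1 1 * (F.exp y).1 1 - 1 := rfl
  rw [this, exp_one, exp_one, mul_one, sub_self]

theorem star_exp_mem (x y : P) : F.star (F.exp x) (F.exp y) - 1 ∈ F.augmentation := by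
  rw [mem_augmentation]
  have : (F.star (F.exp x) (F.exp y) - 1).1 1 =
    F.starQuot 1 ((F.exp x).1 1) ((F.exp y).1 1) - 1 := rfl
  have h1 : F.starQuot 1 1 1 = 1 := by
    have := F.starQuot_mk 1 1 1
    rwa [star_one, map_one] at this
  rw [this, exp_one, exp_one, h1, sub_self]

/-- The Baker–Campbell–Hausdorff product for `[,]`: `log•(exp•(x) • exp•(y))`, as an element
of `P`. -/
noncomputable def bch (x y : P) : P :=
  F.principalPart (F.exp x * F.exp y) (F.mul_exp_mem x y)

/-- The composition product `x ♯ y = log•(exp•(x) * exp•(y))`, as an element of `P`. -/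
noncomputable def sharp (x y : P) : P :=
  F.principalPart (F.star (F.exp x) (F.exp y)) (F.star_exp_mem x y)

end Flows

end CompleteFiltration
end PostLieAlgebra

/-! Everything rests on the coproduct `Δ` of `U(P)` for which the elements of `P` are primitive. The
operator `x * ·`, that is `A ↦ x • A + x ▷ A`, satisfies `Δ(x * A) = (x * · ⊗ 1 + 1 ⊗ x * ·) ΔA`,
because `x` is primitive and the derivation `x ▷ ·` is also a coderivation (`coprod_starOp`). These
operators generate `U(P)` from `1`, so induction gives `A * B = ∑ A₁ • (A₂ ▷ B)` and `A ▷ (B • C) =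
∑ (A₁ ▷ B) • (A₂ ▷ C)`. For a group-like `g` this reads `g * B = g • (g ▷ B)`, with `g ▷ ·`
multiplicative for `•`. Now `exp•(x)` is group-like, whence `exp•(x) * exp•(y) = exp•(x) •
exp•(exp•(x) ▷ y)` (`star_exp`), and the logarithm of this equation is the formula for `♯`. All of
it is checked modulo `Fᵖ`, on truncated exponentials that are group-like up to filtration degree
`p`.

That the logarithms lie in `P` is shown without the Poincaré–Birkhoff–Witt theorem. The Eulerian
idempotent, the convolution logarithm of the identity, takes a group-like element to its logarithm.
On `xⁿ/n!` it acts through the coefficients of `log(exp T) = T`, so it fixes `x` and kills `xⁿ` for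
`n ≠ 1`; by polarization it kills symmetrized words. A word differs from its symmetrization by
shorter words of the same weight, and words of length at least `N` lie in `Fᴺ`; so the truncated
idempotent maps `Fᵖ` into `Pᵖ + Fᴺ` (`eulerian_mem_sup`). Hence a logarithm is congruent to an
element of `P` modulo every `Fᵖ`. The same estimate lets these approximations be chosen Cauchy in
`P`, and completeness gives the limit (`exists_of_eq`).

If the bracket vanishes, `exp•(x) • exp•(y) = exp•(x + y)`, and `P → Û(P)` is injective because
`U(P)` maps to the square-zero extension `k ⊕ P`. -/

namespace PostLieAlgebra

/-! ### Divided powers and truncated exponentials. -/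

section DividedPowers

variable {k A : Type*} [Field k] [CharZero k] [Ring A] [Algebra k A]

variable (k) in
/-- The divided power `aⁿ / n!`. -/
noncomputable def divPow (n : ℕ) (a : A) : A := ((n.factorial : k))⁻¹ • a ^ n

variable (k) in
/-- The truncated exponential series `∑_{n < N} aⁿ / n!`. -/
noncomputable def expTrunc (N : ℕ) (a : A) : A := ∑ n ∈ Finset.range N, divPow k n a

/-- The factorials absorb the binomial coefficients, so divided powers of commuting elements
convolve like the terms of a power series. -/
theorem divPow_add {a b : A} (h : Commute a b) (n : ℕ) :
    divPow k n (a + b) = ∑ m ∈ Finset.HasAntidiagonal.antidiagonal n, divPow k m.1 a * divPow k m.2 b := by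
  rw [divPow, h.add_pow', Finset.smul_sum]
  refine Finset.sum_congr rfl fun m hm => ?_
  rw [divPow, divPow, smul_mul_smul_comm, ← Nat.cast_smul_eq_nsmul k, smul_smul]
  congr 1
  obtain rfl := Finset.HasAntidiagonal.mem_antidiagonal.1 hm
  have h1 : ((m.1 + m.2).factorial : k) ≠ 0 := by exact_mod_cast Nat.factorial_ne_zero _
  have h2 : ((m.1).factorial : k) ≠ 0 := by exact_mod_cast Nat.factorial_ne_zero _
  have h3 : ((m.2).factorial : k) ≠ 0 := by exact_mod_cast Nat.factorial_ne_zero _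
  have h4 : ((m.1 + m.2).choose m.1 : k) * (m.1).factorial * (m.2).factorial =
      (m.1 + m.2).factorial := by
    rw [Nat.choose_symm_add]; exact_mod_cast Nat.add_choose_mul_factorial_mul_factorial m.1 m.2
  field_simp
  linear_combination h4

/-- The functional equation of the exponential series, up to terms of total degree at least `N`. -/
theorem expTrunc_add_sub_mem {a b : A} (h : Commute a b) (N : ℕ) (W : Submodule k A)
    (hW : ∀ i j, N ≤ i + j → a ^ i * b ^ j ∈ W) :
    expTrunc k N (a + b) - expTrunc k N a * expTrunc k N b ∈ W := by
  -- The left side is the triangle `i + j < N` of the square `i, j < N`; what remains of the product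
  -- of the truncations has total degree at least `N`.
  have h1 : expTrunc k N (a + b) = ∑ m ∈ Finset.range N ×ˢ Finset.range N,
      if m.1 + m.2 < N then divPow k m.1 a * divPow k m.2 b else 0 := by
    rw [expTrunc, Finset.sum_congr rfl fun n _ => divPow_add (k := k) h n, Finset.sum_sigma',
      ← Finset.sum_filter]
    refine Finset.sum_nbij' (fun u => u.2) (fun m => ⟨m.1 + m.2, m⟩) ?_ ?_ ?_ ?_ ?_
    · rintro ⟨n, i, j⟩ hu
      simp at hu ⊢; omega
    · rintro ⟨i, j⟩ hu
      simp at hu ⊢; omega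
    · rintro ⟨n, i, j⟩ hu
      simp at hu ⊢; obtain ⟨-, rfl⟩ := hu; simp
    · simp
    · simp
  rw [h1, expTrunc, expTrunc, Finset.sum_mul_sum, ← Finset.sum_product', ← Finset.sum_sub_distrib]
  refine Submodule.sum_mem _ fun m _ => ?_
  split_ifs with hm
  · simp
  · rw [zero_sub, divPow, divPow, smul_mul_smul_comm]
    exact neg_mem (Submodule.smul_mem _ _ (hW _ _ (not_lt.1 hm)))

end DividedPowers

/-! ### The identity `log(exp T) = T` for truncated power series. -/

section LogExp

variable (k : Type*) [Field k]

/-- The coefficients of the series `log (1 + s)`. -/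
noncomputable def logCoeff (n : ℕ) : k := if n = 0 then 0 else (-1) ^ (n + 1) / (n : k)

/-- The power series `exp T - 1`. -/
noncomputable def expSubOne : PowerSeries k :=
  PowerSeries.mk fun n => if n = 0 then 0 else ((n.factorial : k))⁻¹

theorem constantCoeff_expSubOne : PowerSeries.constantCoeff (expSubOne k) = 0 := by
  simp [expSubOne, ← PowerSeries.coeff_zero_eq_constantCoeff_apply]

variable [CharZero k]

theorem derivative_expSubOne : PowerSeries.derivative k (expSubOne k) = 1 + expSubOne k := by
  ext n
  rw [PowerSeries.coeff_derivative, map_add, PowerSeries.coeff_one]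
  simp only [expSubOne, PowerSeries.coeff_mk]
  rcases n with _ | n
  · simp
  · have h2 : ((n + 1).factorial : k) ≠ 0 := by exact_mod_cast Nat.factorial_ne_zero _
    have h3 : ((n + 1 : ℕ) : k) + 1 ≠ 0 := by exact_mod_cast Nat.succ_ne_zero (n + 1)
    rw [if_neg (by omega), if_neg (by omega), if_neg (by omega), zero_add, Nat.factorial_succ (n + 1)]
    push_cast at h3 ⊢
    field_simp

/-- The truncated composite of `log` and `exp` agrees with the identity. -/
theorem coeff_log_exp {N n : ℕ} (h : n < N) :
    ∑ j ∈ Finset.range N, logCoeff k j * PowerSeries.coeff n (expSubOne k ^ j) =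
      if n = 1 then 1 else 0 := by
  set s := expSubOne k with hs
  rcases n with _ | n
  · rw [if_neg (by omega)]
    refine Finset.sum_eq_zero fun j _ => ?_
    rcases j with _ | j
    · simp [logCoeff]
    · simp [PowerSeries.coeff_zero_eq_constantCoeff_apply, hs, constantCoeff_expSubOne]
  -- The term of index `0` has coefficient `0`, so only `M` terms survive differentiation.
  obtain ⟨M, rfl⟩ : ∃ M, N = M + 1 := ⟨N - 1, by omega⟩
  -- Since `s' = 1 + s`, the derivative is the geometric sum of `(-s)^j (1 - (-s))` over `j < M`,
  -- which telescopes.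
  have hd : PowerSeries.derivative k (∑ j ∈ Finset.range (M + 1), logCoeff k j • s ^ j) =
      1 - (-s) ^ M := by
    rw [Finset.sum_range_succ', map_add, map_sum]
    have : ∀ j ∈ Finset.range M, PowerSeries.derivative k (logCoeff k (j + 1) • s ^ (j + 1)) =
        (-s) ^ j * (1 - (-s)) := by
      intro j _
      rw [Derivation.map_smul, Derivation.leibniz_pow, hs, derivative_expSubOne, ← hs, logCoeff,
        if_neg (by omega), neg_pow, ← Nat.cast_smul_eq_nsmul k, smul_smul,
        div_mul_cancel₀ _ (by exact_mod_cast Nat.succ_ne_zero j), Nat.add_sub_cancel, smul_eq_mul,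
        sub_neg_eq_add, PowerSeries.smul_eq_C_mul]
      simp [pow_succ]
      ring
    rw [Finset.sum_congr rfl this, ← Finset.sum_mul, geom_sum_mul_neg]
    simp [logCoeff]
  have h1 := congrArg (PowerSeries.coeff n) hd
  rw [PowerSeries.coeff_derivative] at h1
  -- As `s` has no constant term, `(-s)^M` has order at least `M > n`.
  have h2 : PowerSeries.coeff n ((-s) ^ M) = 0 := by
    refine PowerSeries.coeff_of_lt_order _ (lt_of_lt_of_le ?_
      (PowerSeries.le_order_pow_of_constantCoeff_eq_zero M ?_))
    · exact_mod_cast (by omega : n < M)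
    · rw [map_neg, hs, constantCoeff_expSubOne, neg_zero]
  rw [map_sub, h2, sub_zero, PowerSeries.coeff_one, map_sum] at h1
  simp only [map_smul, smul_eq_mul] at h1
  have h3 : ((n : k) + 1) ≠ 0 := by exact_mod_cast Nat.succ_ne_zero n
  rw [← mul_left_inj' h3, h1]
  rcases n with _ | n <;> simp

end LogExp

/-! ### Polarization in a noncommutative ring. -/

section Polarization

variable {A : Type*} [Ring A]

/-- Multilinearity expands the power into one word for each map into `s`. Summing over all maps,
with zero terms, makes the index set independent of `s`, so that sums over `s` can be exchanged with
it. -/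
theorem sum_pow_eq_sum_ofFn {n : ℕ} (x : Fin n → A) (s : Finset (Fin n)) :
    (∑ i ∈ s, x i) ^ n = ∑ r : Fin n → Fin n, if ∀ i, r i ∈ s then
      (List.ofFn fun i => x (r i)).prod else 0 := by
  have h := (MultilinearMap.mkPiAlgebraFin ℤ n A).map_sum_finset (fun _ i => x i) (fun _ => s)
  rw [MultilinearMap.mkPiAlgebraFin_apply_const] at h
  rw [h, ← Finset.sum_filter]
  refine Finset.sum_congr ?_ fun r _ => ?_
  · ext r; simp
  · rw [MultilinearMap.mkPiAlgebraFin_apply]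

/-- Polarization: a symmetrized product is a linear combination of `n`-th powers. -/
theorem sum_perm_ofFn {n : ℕ} (x : Fin n → A) :
    ∑ σ : Equiv.Perm (Fin n), (List.ofFn fun i => x (σ i)).prod =
      ∑ t : Finset (Fin n), (-1 : ℤ) ^ t.card • (∑ i ∈ tᶜ, x i) ^ n := by
  simp only [sum_pow_eq_sum_ofFn, Finset.smul_sum]
  rw [Finset.sum_comm]
  -- Inclusion–exclusion: the word of `r` occurs for exactly those `t` that avoid the image of `r`,
  -- and the signs cancel unless the complement of the image is empty.
  have key : ∀ r : Fin n → Fin n, (∑ t : Finset (Fin n), (-1 : ℤ) ^ t.card •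
      (if ∀ i, r i ∈ tᶜ then (List.ofFn fun i => x (r i)).prod else 0)) =
      if Function.Surjective r then (List.ofFn fun i => x (r i)).prod else 0 := by
    intro r
    simp only [smul_ite, smul_zero]
    rw [← Finset.sum_filter, ← Finset.sum_smul]
    have h1 : (Finset.univ.filter fun t : Finset (Fin n) => ∀ i, r i ∈ tᶜ) =
        ((Finset.univ.image r)ᶜ).powerset := by
      ext t
      simp only [Finset.mem_filter_univ, Finset.mem_compl, Finset.mem_powerset]
      constructor
      · intro h j hj
        simp only [Finset.mem_compl, Finset.mem_image, Finset.mem_univ, true_and, not_exists]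
        rintro i rfl
        exact h i hj
      · intro h i hi
        have := h hi
        simp at this
    rw [h1, Finset.sum_powerset_neg_one_pow_card]
    have h2 : (Finset.univ.image r)ᶜ = ∅ ↔ Function.Surjective r := by
      rw [Finset.compl_eq_empty_iff, Finset.eq_univ_iff_forall]; simp [Function.Surjective]
    simp only [h2]
    split_ifs <;> simp
  rw [Finset.sum_congr rfl fun r _ => key r]
  -- The surjective self-maps of a finite set are the permutations.
  refine Finset.sum_of_injOn (fun σ => ⇑σ) (fun a _ b _ h => DFunLike.coe_injective h) (by simp)
    ?_ ?_
  · intro r _ hr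
    rw [if_neg]
    intro hs
    exact hr ⟨Equiv.ofBijective r (Finite.injective_iff_bijective.1
      (Finite.injective_iff_surjective.2 hs)), by simp, rfl⟩
  · intro σ _
    rw [if_pos σ.surjective]

end Polarization

end PostLieAlgebra

namespace PostLieAlgebra

/-! ### The coproduct and counit of the enveloping algebra. -/

section Coproduct

open scoped TensorProduct

variable {k P : Type*} [CommRing k] [LieRing P] [LieAlgebra k P]

/-- The stronger claim that multiplication by `a` on the left preserves `C` is stable under products
in `a`, so it need only be known for letters. -/
theorem env_left_induction {C : UniversalEnvelopingAlgebra k P → Prop} (h1 : C 1)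
    (hs : ∀ (r : k) a, C a → C (r • a)) (ha : ∀ a b, C a → C b → C (a + b))
    (hx : ∀ x a, C a → C (incl k P x * a)) (a : UniversalEnvelopingAlgebra k P) : C a := by
  have key : ∀ b, C b → C (a * b) := by
    induction a using env_induction with
    | h0 r => intro b hb; rw [← Algebra.smul_def]; exact hs r b hb
    | hι x => exact hx x
    | hm a b h1 h2 => intro c hc; rw [mul_assoc]; exact h1 _ (h2 _ hc)
    | ha a b h1 h2 => intro c hc; rw [add_mul]; exact ha _ _ (h1 _ hc) (h2 _ hc)
  simpa using key 1 h1

variable (k P) in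
/-- The coproduct of the enveloping algebra, for which the elements of `P` are primitive. -/
noncomputable def coprod : UniversalEnvelopingAlgebra k P →ₐ[k]
    UniversalEnvelopingAlgebra k P ⊗[k] UniversalEnvelopingAlgebra k P :=
  envLift ((TensorProduct.mk k _ _).flip 1 ∘ₗ incl k P + TensorProduct.mk k _ _ 1 ∘ₗ incl k P) (by
    intro x y
    simp [incl_lie, TensorProduct.tmul_sub, mul_add, add_mul]
    abel)

@[simp] theorem coprod_incl (x : P) :
    coprod k P (incl k P x) = incl k P x ⊗ₜ 1 + 1 ⊗ₜ incl k P x := by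
  simp [coprod]

variable (k P) in
/-- The counit of the enveloping algebra. -/
noncomputable def counit : UniversalEnvelopingAlgebra k P →ₐ[k] k := envLift 0 (by simp)

@[simp] theorem counit_incl (x : P) : counit k P (incl k P x) = 0 := by simp [counit]

theorem counit_envDer (f : Module.End k P) (hf : ∀ y z, f ⁅y, z⁆ = ⁅f y, z⁆ + ⁅y, f z⁆)
    (a : UniversalEnvelopingAlgebra k P) : counit k P (envDer f hf a) = 0 := by
  induction a using env_induction with
  | h0 r => simp
  | hι x => simp
  | hm a b h1 h2 => simp [envDer_mul, h1, h2]
  | ha a b h1 h2 => simp [h1, h2]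

/-- With `D` the extended derivation, `D ⊗ 1 + 1 ⊗ D` is a derivation of the tensor square (`hmul`).
Both sides are therefore derivations in `a` along the coproduct, and they agree on letters. -/
theorem coprod_envDer (f : Module.End k P) (hf : ∀ y z, f ⁅y, z⁆ = ⁅f y, z⁆ + ⁅y, f z⁆)
    (a : UniversalEnvelopingAlgebra k P) : coprod k P (envDer f hf a) =
      (envDer f hf).rTensor _ (coprod k P a) + (envDer f hf).lTensor _ (coprod k P a) := by
  have h1 : envDer f hf 1 = 0 := by simpa using envDer_algebraMap f hf 1
  have hmul : ∀ s t : UniversalEnvelopingAlgebra k P ⊗[k] UniversalEnvelopingAlgebra k P,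
      (envDer f hf).rTensor _ (s * t) + (envDer f hf).lTensor _ (s * t) =
      ((envDer f hf).rTensor _ s + (envDer f hf).lTensor _ s) * t +
        s * ((envDer f hf).rTensor _ t + (envDer f hf).lTensor _ t) := by
    intro s t
    induction s using TensorProduct.induction_on with
    | zero => simp
    | add s s' hs hs' =>
      simp only [add_mul, map_add] at hs hs' ⊢
      rw [add_add_add_comm, hs, hs']; abel
    | tmul a b =>
      induction t using TensorProduct.induction_on with
      | zero => simp
      | add t t' ht ht' =>
        simp only [mul_add, map_add] at ht ht' ⊢
        rw [add_add_add_comm, ht, ht']; abel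
      | tmul c d =>
        simp only [Algebra.TensorProduct.tmul_mul_tmul, LinearMap.rTensor_tmul,
          LinearMap.lTensor_tmul, envDer_mul, TensorProduct.add_tmul, TensorProduct.tmul_add,
          add_mul, mul_add]
        abel
  induction a using env_induction with
  | h0 r =>
    rw [envDer_algebraMap, map_zero, Algebra.algebraMap_eq_smul_one, map_smul, map_one,
      Algebra.TensorProduct.one_def]
    simp [h1]
  | hι x => simp [h1]
  | hm a b h1 h2 => rw [envDer_mul, map_add, map_mul, map_mul, map_mul, h1, h2, hmul]
  | ha a b h1 h2 => simp only [map_add, h1, h2]; abel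

end Coproduct

/-! ### The action of `(U(P), *)` on `(U(P), •)` and its coproduct formulas. -/

section EnvelopingAction

open scoped TensorProduct

variable {k P : Type*} [CommRing k] [LieRing P] [LieAlgebra k P] [PostLieAlgebra k P]

/-- As an algebra for `*`, `U(P)` is generated by `P`. A statement linear in `A` thus needs checking
only for `1` and under `x * ·`, where the actions and the coproduct have simple recursions. -/
theorem star_induction {C : UniversalEnvelopingAlgebra k P → Prop} (h1 : C 1)
    (hs : ∀ (r : k) A, C A → C (r • A)) (ha : ∀ A B, C A → C B → C (A + B))
    (hx : ∀ x A, C A → C (starOp k P x A)) (A : UniversalEnvelopingAlgebra k P) : C A := by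
  obtain ⟨a, rfl⟩ := (envEquiv k P).surjective A
  induction a using env_left_induction with
  | h1 => simpa using h1
  | hs r a h => rw [map_smul]; exact hs _ _ h
  | ha a b h1 h2 => rw [map_add]; exact ha _ _ h1 h2
  | hx x a h =>
    obtain ⟨x, rfl⟩ := (toDouble k P).surjective x
    rw [envEquiv_mul, ← starOp_apply]; exact hx _ _ h

theorem starProd_starOp (x : P) (A B : UniversalEnvelopingAlgebra k P) :
    starProd k P (starOp k P x A) B = starOp k P x (starProd k P A B) := by
  rw [starOp_apply, ← star_incl, star_assoc, star_incl, starOp_apply]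

variable (k P) in
/-- The linear map `x ↦ x ▷ ·` from `P` to the endomorphisms of `U(P)`. -/
noncomputable def triDerₗ : P →ₗ[k] Module.End k (UniversalEnvelopingAlgebra k P) where
  toFun x := triDer x
  map_add' x y := by
    ext1 a; obtain ⟨a, rfl⟩ := mkAlgHom_surjective a
    simp [triDer_mk, tensorDer_add]
  map_smul' r x := by
    ext1 a; obtain ⟨a, rfl⟩ := mkAlgHom_surjective a
    simp [triDer_mk, tensorDer_smul]

variable (k P) in
/-- The action of `U(P, ⟦,⟧)` on `U(P)` in which `x` acts by the derivation `x ▷ ·`. -/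
noncomputable def doubleEnvAction :
    UniversalEnvelopingAlgebra k (Double k P) →ₐ[k] Module.End k (UniversalEnvelopingAlgebra k P) :=
  envLift (triDerₗ k P ∘ₗ (toDouble k P).symm.toLinearMap) (by
    intro x y
    obtain ⟨x, rfl⟩ := (toDouble k P).surjective x
    obtain ⟨y, rfl⟩ := (toDouble k P).surjective y
    ext1 a
    obtain ⟨a, rfl⟩ := mkAlgHom_surjective a
    have h := congrArg (UniversalEnvelopingAlgebra.mkAlgHom k P) (tensorDer_double x y a)
    simp only [map_add, map_sub, ← triDer_mk] at h
    rw [double_lie]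
    simp only [LinearMap.comp_apply, LinearEquiv.coe_coe, LinearEquiv.symm_apply_apply, map_add,
      map_sub, LinearMap.sub_apply, LinearMap.add_apply, Module.End.mul_apply]
    exact h.symm)

variable (k P) in
/-- The action `A ▷ B` of `(U(P), *)` on `U(P)` that extends the action on `P`. -/
noncomputable def envAction :
    UniversalEnvelopingAlgebra k P →ₗ[k] Module.End k (UniversalEnvelopingAlgebra k P) :=
  (doubleEnvAction k P).toLinearMap ∘ₗ (envEquiv k P).symm.toLinearMap

@[simp] theorem envAction_one (B : UniversalEnvelopingAlgebra k P) : envAction k P 1 B = B := by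
  simp [envAction]

theorem envEquiv_symm_starOp (x : P) (A : UniversalEnvelopingAlgebra k P) :
    (envEquiv k P).symm (starOp k P x A) =
      incl k (Double k P) (toDouble k P x) * (envEquiv k P).symm A := by
  rw [LinearEquiv.symm_apply_eq, envEquiv_mul, LinearEquiv.apply_symm_apply, starOp_apply]

theorem envAction_starOp (x : P) (A B : UniversalEnvelopingAlgebra k P) :
    envAction k P (starOp k P x A) B = triDer x (envAction k P A B) := by
  simp [envAction, envEquiv_symm_starOp, doubleEnvAction, triDerₗ]

theorem triAction_starOp (x : P) (A : UniversalEnvelopingAlgebra k P) (y : P) :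
    triAction k P (starOp k P x A) y = tri (k := k) x (triAction k P A y) := by
  rw [starOp_apply, ← star_incl, triAction_star, triAction_incl]

theorem triDer_incl (x y : P) : triDer x (incl k P y) = incl k P (tri (k := k) x y) :=
  envDer_incl _ _ _

theorem triDer_mul (x : P) (a b : UniversalEnvelopingAlgebra k P) :
    triDer x (a * b) = triDer x a * b + a * triDer x b := envDer_mul _ _ _ _

theorem envAction_incl (A : UniversalEnvelopingAlgebra k P) (y : P) :
    envAction k P A (incl k P y) = incl k P (triAction k P A y) := by
  induction A using star_induction with
  | h1 => simp [triAction_one]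
  | hs r A h => simp [h]
  | ha A B h1 h2 => simp [h1, h2]
  | hx x A h => rw [envAction_starOp, h, triDer_incl, triAction_starOp]

/-- Each letter acts by a derivation, which kills scalars; only the component of `A` outside the
augmentation ideal survives. -/
theorem envAction_one_right (A : UniversalEnvelopingAlgebra k P) :
    envAction k P A 1 = algebraMap k _ (counit k P A) := by
  induction A using star_induction with
  | h1 => simp
  | hs r A h =>
    rw [map_smul, LinearMap.smul_apply, h, map_smul, smul_eq_mul, map_mul, Algebra.smul_def]
  | ha A B h1 h2 => simp [h1, h2]
  | hx x A h =>
    rw [envAction_starOp, h, starOp_apply, map_add, map_mul, counit_incl, zero_mul, zero_add,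
      triDer, counit_envDer, map_zero, envDer_algebraMap]

/-- The coproduct is compatible with `*` as well as with `•`: primitivity of `x` accounts for the
term `x • A`, and the coderivation property of `x ▷ ·` for the term `x ▷ A`. -/
theorem coprod_starOp (x : P) (A : UniversalEnvelopingAlgebra k P) :
    coprod k P (starOp k P x A) =
      (starOp k P x).rTensor _ (coprod k P A) + (starOp k P x).lTensor _ (coprod k P A) := by
  have h : ∀ t : UniversalEnvelopingAlgebra k P ⊗[k] UniversalEnvelopingAlgebra k P,
      (incl k P x ⊗ₜ[k] 1 + 1 ⊗ₜ[k] incl k P x) * t + ((triDer x).rTensor _ t +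
        (triDer x).lTensor _ t) = (starOp k P x).rTensor _ t + (starOp k P x).lTensor _ t := by
    intro t
    induction t using TensorProduct.induction_on with
    | zero => simp
    | add s t hs ht => simp only [map_add, mul_add] at hs ht ⊢; linear_combination (norm := abel) hs + ht
    | tmul a b =>
      simp only [add_mul, Algebra.TensorProduct.tmul_mul_tmul, LinearMap.rTensor_tmul,
        LinearMap.lTensor_tmul, starOp_apply, TensorProduct.add_tmul, TensorProduct.tmul_add,
        one_mul]
      abel
  rw [← h, starOp_apply, map_add, map_mul, coprod_incl, triDer, coprod_envDer]

/-- `A * B = ∑ A₁ • (A₂ ▷ B)`. -/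
theorem starProd_eq_coprod (A B : UniversalEnvelopingAlgebra k P) : starProd k P A B =
    TensorProduct.lift ((LinearMap.mul k _).compl₂ ((envAction k P).flip B)) (coprod k P A) := by
  -- On `a ⊗ b` the Leibniz rule gives `x * (a • (b ▷ B)) = (x * a) • (b ▷ B) + a • ((x * b) ▷ B)`,
  -- so both sides of the theorem obey the same recursion.
  have h : ∀ (x : P) (t : UniversalEnvelopingAlgebra k P ⊗[k] UniversalEnvelopingAlgebra k P),
      TensorProduct.lift ((LinearMap.mul k _).compl₂ ((envAction k P).flip B))
        ((starOp k P x).rTensor _ t + (starOp k P x).lTensor _ t) =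
      starOp k P x (TensorProduct.lift
        ((LinearMap.mul k _).compl₂ ((envAction k P).flip B)) t) := by
    intro x t
    induction t using TensorProduct.induction_on with
    | zero => simp
    | add s t hs ht => simp only [map_add] at hs ht ⊢; rw [← hs, ← ht]; abel
    | tmul a b =>
      simp [envAction_starOp]
      simp only [starOp_apply, triDer_mul, add_mul, mul_assoc]
      abel
  induction A using star_induction with
  | h1 => simp [one_star, Algebra.TensorProduct.one_def]
  | hs r A h => rw [map_smul, map_smul, ← h]; simp [starProd]
  | ha A C h1 h2 => rw [map_add, map_add, ← h1, ← h2]; simp [starProd, add_mul]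
  | hx x A ih => rw [coprod_starOp, h, ← ih, starProd_starOp]

/-- `A ▷ (B • C) = ∑ (A₁ ▷ B) • (A₂ ▷ C)`. -/
theorem envAction_mul (A B C : UniversalEnvelopingAlgebra k P) : envAction k P A (B * C) =
    TensorProduct.lift ((LinearMap.mul k _).compl₁₂ ((envAction k P).flip B)
      ((envAction k P).flip C)) (coprod k P A) := by
  -- This is again the Leibniz rule for `x ▷ ·`, together with `(x * a) ▷ B = x ▷ (a ▷ B)`.
  have h : ∀ (x : P) (t : UniversalEnvelopingAlgebra k P ⊗[k] UniversalEnvelopingAlgebra k P),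
      TensorProduct.lift ((LinearMap.mul k _).compl₁₂ ((envAction k P).flip B)
        ((envAction k P).flip C)) ((starOp k P x).rTensor _ t + (starOp k P x).lTensor _ t) =
      triDer x (TensorProduct.lift ((LinearMap.mul k _).compl₁₂ ((envAction k P).flip B)
        ((envAction k P).flip C)) t) := by
    intro x t
    induction t using TensorProduct.induction_on with
    | zero => simp
    | add s t hs ht => simp only [map_add] at hs ht ⊢; rw [← hs, ← ht]; abel
    | tmul a b => simp [envAction_starOp, triDer_mul]
  induction A using star_induction with
  | h1 => simp [Algebra.TensorProduct.one_def]
  | hs r A h => rw [map_smul, map_smul, LinearMap.smul_apply, h, map_smul]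
  | ha A C h1 h2 => rw [map_add, map_add, LinearMap.add_apply, h1, h2, map_add]
  | hx x A ih => rw [coprod_starOp, h, ← ih, envAction_starOp]

end EnvelopingAction

end PostLieAlgebra

namespace PostLieAlgebra

theorem map_expTrunc {k A B : Type*} [Field k] [Ring A] [Algebra k A] [Ring B]
    [Algebra k B] (f : A →ₐ[k] B) (N : ℕ) (a : A) :
    f (expTrunc k N a) = expTrunc k N (f a) := by
  simp [expTrunc, divPow, map_sum]

namespace CompleteFiltration

open scoped TensorProduct

/-! ### Filtered estimates and elements that are group-like up to degree `p`. -/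

section TensorFiltration

variable {k P : Type*} [CommRing k] [LieRing P] [LieAlgebra k P] [PostLieAlgebra k P]
variable (F : CompleteFiltration k P)

/-- The filtration of `U(P) ⊗ U(P)` spanned by the `a ⊗ b` with `a ∈ Fⁱ`, `b ∈ Fʲ`, `i + j ≥ p`. -/
noncomputable def tensorFil (p : ℕ) :
    Submodule k (UniversalEnvelopingAlgebra k P ⊗[k] UniversalEnvelopingAlgebra k P) :=
  Submodule.span k {t | ∃ (i j : ℕ) (a b : UniversalEnvelopingAlgebra k P),
    p ≤ i + j ∧ a ∈ F.envFil i ∧ b ∈ F.envFil j ∧ t = a ⊗ₜ b}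

variable {F}

theorem envFil_anti {p q : ℕ} (h : p ≤ q) {a : UniversalEnvelopingAlgebra k P}
    (ha : a ∈ F.envFil q) : a ∈ F.envFil p := wordSpan_anti h ha

theorem envFil_mul {p q : ℕ} {a b : UniversalEnvelopingAlgebra k P}
    (ha : a ∈ F.envFil p) (hb : b ∈ F.envFil q) : a * b ∈ F.envFil (p + q) := wordSpan_mul ha hb

theorem tmul_mem_tensorFil {p i j : ℕ} {a b : UniversalEnvelopingAlgebra k P} (h : p ≤ i + j)
    (ha : a ∈ F.envFil i) (hb : b ∈ F.envFil j) : a ⊗ₜ[k] b ∈ F.tensorFil p :=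
  Submodule.subset_span ⟨i, j, a, b, h, ha, hb, rfl⟩

theorem lift_mem_of_mem_tensorFil {M : Type*} [AddCommGroup M] [Module k M]
    {f : UniversalEnvelopingAlgebra k P →ₗ[k] UniversalEnvelopingAlgebra k P →ₗ[k] M}
    {W : Submodule k M} {p : ℕ}
    (h : ∀ i j a b, p ≤ i + j → a ∈ F.envFil i → b ∈ F.envFil j → f a b ∈ W)
    {t : UniversalEnvelopingAlgebra k P ⊗[k] UniversalEnvelopingAlgebra k P}
    (ht : t ∈ F.tensorFil p) : TensorProduct.lift f t ∈ W := by
  refine (Submodule.span_le (p := W.comap (TensorProduct.lift f))).2 ?_ ht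
  rintro _ ⟨i, j, a, b, hp, ha, hb, rfl⟩
  exact h i j a b hp ha hb

theorem mem_tensorFil_zero
    (t : UniversalEnvelopingAlgebra k P ⊗[k] UniversalEnvelopingAlgebra k P) :
    t ∈ F.tensorFil 0 := by
  induction t using TensorProduct.induction_on with
  | zero => exact zero_mem _
  | add s t hs ht => exact add_mem hs ht
  | tmul a b => exact tmul_mem_tensorFil (Nat.zero_le _) (F.mem_envFil_zero a) (F.mem_envFil_zero b)

theorem tensorFil_mul {p q : ℕ}
    {s t : UniversalEnvelopingAlgebra k P ⊗[k] UniversalEnvelopingAlgebra k P}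
    (hs : s ∈ F.tensorFil p) (ht : t ∈ F.tensorFil q) : s * t ∈ F.tensorFil (p + q) := by
  have h := Submodule.mul_mem_mul hs ht
  rw [tensorFil, tensorFil, Submodule.span_mul_span] at h
  refine Submodule.span_mono ?_ h
  rintro _ ⟨_, ⟨i, j, a, b, hp, ha, hb, rfl⟩, _, ⟨i', j', a', b', hp', ha', hb', rfl⟩, rfl⟩
  exact ⟨i + i', j + j', a * a', b * b', by omega, wordSpan_mul ha ha', wordSpan_mul hb hb', by
    simp⟩

/-- A letter of weight `i` goes to `x ⊗ 1 + 1 ⊗ x`, both of total weight `i`, and the coproduct is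
multiplicative. -/
theorem coprod_mem {p : ℕ} {a : UniversalEnvelopingAlgebra k P} (ha : a ∈ F.envFil p) :
    coprod k P a ∈ F.tensorFil p := by
  refine (Submodule.span_le (p := (F.tensorFil p).comap (coprod k P).toLinearMap)).2 ?_ ha
  rintro _ ⟨l, hl, hp, rfl⟩
  have key : coprod k P (l.map fun u => incl k P u.2).prod ∈
      F.tensorFil (l.map Prod.fst).sum := by
    clear hp
    induction l with
    | nil => exact mem_tensorFil_zero _
    | cons u l ih =>
      have hu : incl k P u.2 ∈ F.envFil u.1 := letter_mem (hl u (by simp))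
      simp only [List.map_cons, List.prod_cons, List.sum_cons, map_mul, coprod_incl]
      refine tensorFil_mul (add_mem ?_ ?_) (ih fun v hv => hl v (by simp [hv]))
      · exact tmul_mem_tensorFil le_rfl hu (F.mem_envFil_zero 1)
      · exact tmul_mem_tensorFil (by simp) (F.mem_envFil_zero 1) hu
  refine Submodule.span_mono ?_ key
  rintro _ ⟨i, j, a, b, h, ha, hb, rfl⟩
  exact ⟨i, j, a, b, hp.trans h, ha, hb, rfl⟩

theorem counit_eq_zero {a : UniversalEnvelopingAlgebra k P} (ha : a ∈ F.envFil 1) :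
    counit k P a = 0 := by
  refine (Submodule.span_le (p := LinearMap.ker (counit k P).toLinearMap)).2 ?_ ha
  rintro _ ⟨l, hl, hp, rfl⟩
  rcases l with _ | ⟨u, l⟩
  · simp at hp
  · simp

/-- The identification with the enveloping algebra of `(P, ⟦,⟧)` preserves weights, and there a word
acts letter by letter through `x ▷ ·`, each letter adding its weight. -/
theorem envAction_mem {p q : ℕ} {a b : UniversalEnvelopingAlgebra k P} (ha : a ∈ F.envFil p)
    (hb : b ∈ F.envFil q) : envAction k P a b ∈ F.envFil (p + q) := by
  have ha' := F.envEquiv_symm_mem ha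
  rw [envAction, LinearMap.comp_apply]
  refine (Submodule.span_le (p := (F.envFil (p + q)).comap
    ((doubleEnvAction k P).toLinearMap.flip b))).2 ?_ ha'
  rintro _ ⟨l, hl, hp, rfl⟩
  refine envFil_anti (F := F) (Nat.add_le_add_right hp q) ?_
  clear hp
  induction l with
  | nil => simpa using hb
  | cons u l ih =>
    have h2 := F.triDer_mem (hl u (by simp)) (ih fun v hv => hl v (by simp [hv]))
    rw [← add_assoc] at h2
    simpa [doubleEnvAction, triDerₗ] using h2

variable (F) in
/-- `g = 1 + ⋯` is group-like up to terms of filtration degree `p`. -/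
structure IsGroupLikeMod (p : ℕ) (g : UniversalEnvelopingAlgebra k P) : Prop where
  sub_one_mem : g - 1 ∈ F.envFil 1
  coprod_sub_mem : coprod k P g - g ⊗ₜ[k] g ∈ F.tensorFil p

namespace IsGroupLikeMod

variable {p : ℕ} {g h : UniversalEnvelopingAlgebra k P}

theorem counit_eq_one (hg : F.IsGroupLikeMod p g) : counit k P g = 1 := by
  have := counit_eq_zero hg.sub_one_mem
  rwa [map_sub, map_one, sub_eq_zero] at this

theorem mul (hg : F.IsGroupLikeMod p g) (hh : F.IsGroupLikeMod p h) :
    F.IsGroupLikeMod p (g * h) where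
  sub_one_mem := by
    have h1 := envFil_mul hg.sub_one_mem (F.mem_envFil_zero h)
    rw [add_zero] at h1
    have := add_mem h1 hh.sub_one_mem
    -- `gh - 1 = (g - 1)h + (h - 1)`.
    convert this using 1
    noncomm_ring
  coprod_sub_mem := by
    have h1 := tensorFil_mul hg.coprod_sub_mem (mem_tensorFil_zero (F := F) (coprod k P h))
    have h2 := tensorFil_mul (mem_tensorFil_zero (F := F) (g ⊗ₜ[k] g)) hh.coprod_sub_mem
    rw [add_zero] at h1
    rw [zero_add] at h2
    -- `Δg Δh - (g ⊗ g)(h ⊗ h) = (Δg - g ⊗ g) Δh + (g ⊗ g)(Δh - h ⊗ h)`.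
    convert add_mem h1 h2 using 1
    rw [map_mul, ← Algebra.TensorProduct.tmul_mul_tmul]
    noncomm_ring

/-- The general substitution rule: in any bilinear expression that respects the filtrations, `Δg`
may be replaced by `g ⊗ g`. Each coproduct formula is specialized to group-like elements through it.
-/
theorem mk_lift_coprod (hg : F.IsGroupLikeMod p g)
    {f : UniversalEnvelopingAlgebra k P →ₗ[k] UniversalEnvelopingAlgebra k P →ₗ[k]
      UniversalEnvelopingAlgebra k P}
    (hf : ∀ i j a b, p ≤ i + j → a ∈ F.envFil i → b ∈ F.envFil j → f a b ∈ F.envFil p) :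
    Ideal.Quotient.mk (F.envIdeal p) (TensorProduct.lift f (coprod k P g)) =
      Ideal.Quotient.mk (F.envIdeal p) (f g g) := by
  refine Ideal.Quotient.eq.2 (F.mem_envIdeal.2 ?_)
  have := lift_mem_of_mem_tensorFil hf hg.coprod_sub_mem
  rwa [map_sub, TensorProduct.lift.tmul] at this

theorem mk_starProd (hg : F.IsGroupLikeMod p g) (B : UniversalEnvelopingAlgebra k P) :
    Ideal.Quotient.mk (F.envIdeal p) (starProd k P g B) =
      Ideal.Quotient.mk (F.envIdeal p) (g * envAction k P g B) := by
  rw [starProd_eq_coprod, hg.mk_lift_coprod]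
  · simp
  · intro i j a b h ha hb
    have h1 := envFil_mul ha (envAction_mem hb (F.mem_envFil_zero B))
    have h2 : a * envAction k P b B ∈ F.envFil p := envFil_anti (by omega) h1
    simpa using h2

theorem mk_envAction_mul (hg : F.IsGroupLikeMod p g) (B C : UniversalEnvelopingAlgebra k P) :
    Ideal.Quotient.mk (F.envIdeal p) (envAction k P g (B * C)) =
      Ideal.Quotient.mk (F.envIdeal p) (envAction k P g B * envAction k P g C) := by
  rw [envAction_mul, hg.mk_lift_coprod]
  · simp
  · intro i j a b h ha hb
    have h1 := envFil_mul (envAction_mem ha (F.mem_envFil_zero B))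
      (envAction_mem hb (F.mem_envFil_zero C))
    have h2 : envAction k P a B * envAction k P b C ∈ F.envFil p := envFil_anti (by omega) h1
    simpa using h2

theorem mk_envAction_pow (hg : F.IsGroupLikeMod p g) (B : UniversalEnvelopingAlgebra k P) (n : ℕ) :
    Ideal.Quotient.mk (F.envIdeal p) (envAction k P g (B ^ n)) =
      Ideal.Quotient.mk (F.envIdeal p) (envAction k P g B ^ n) := by
  induction n with
  | zero => rw [pow_zero, pow_zero, envAction_one_right, hg.counit_eq_one, map_one]
  | succ n ih => rw [pow_succ, hg.mk_envAction_mul, map_mul, ih, ← map_mul, ← pow_succ]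

end IsGroupLikeMod

end TensorFiltration

/-! ### Exponentials are group-like; the two products of exponentials. -/

section Exponentials

variable {k P : Type*} [Field k] [LieRing P] [LieAlgebra k P] [PostLieAlgebra k P]
variable {F : CompleteFiltration k P}

theorem IsGroupLikeMod.mk_envAction_expTrunc {p : ℕ} {g : UniversalEnvelopingAlgebra k P}
    (hg : F.IsGroupLikeMod p g) (N : ℕ) (B : UniversalEnvelopingAlgebra k P) :
    Ideal.Quotient.mk (F.envIdeal p) (envAction k P g (expTrunc k N B)) =
      Ideal.Quotient.mk (F.envIdeal p) (expTrunc k N (envAction k P g B)) := by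
  have h : ∀ a : UniversalEnvelopingAlgebra k P,
    Ideal.Quotient.mk (F.envIdeal p) a = Ideal.Quotient.mkₐ k (F.envIdeal p) a := fun _ => rfl
  have h2 := fun n => hg.mk_envAction_pow B n
  simp only [h] at h2 ⊢
  simp only [expTrunc, divPow, map_sum, map_smul, h2]

theorem exp_val (x : P) (p : ℕ) :
    (F.exp x).1 p = Ideal.Quotient.mk (F.envIdeal p) (expTrunc k p (incl k P x)) := by
  change _ = Ideal.Quotient.mkₐ k (F.envIdeal p) _
  rw [map_expTrunc]
  rfl

theorem incl_mem_envFil_one (x : P) : incl k P x ∈ F.envFil 1 :=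
  letter_mem (by rw [F.fil_one]; trivial)

/-- The bound on `p` matters: the truncation to no terms is `0` and lacks the leading `1`. -/
theorem expTrunc_sub_one_mem (x : P) {p : ℕ} (hp : 1 ≤ p) :
    expTrunc k p (incl k P x) - 1 ∈ F.envFil 1 := by
  obtain ⟨p, rfl⟩ : ∃ q, p = q + 1 := ⟨p - 1, by omega⟩
  rw [expTrunc, Finset.sum_range_succ']
  have : divPow k 0 (incl k P x) = 1 := by simp [divPow]
  rw [this, add_sub_cancel_right]
  refine Submodule.sum_mem _ fun n _ => Submodule.smul_mem _ _ ?_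
  exact envFil_anti (by omega) (F.pow_mem_envFil (incl_mem_envFil_one x) (n + 1))

variable [CharZero k]

/-- `Δ` sends `x` to the sum of the commuting elements `x ⊗ 1` and `1 ⊗ x`, so the functional
equation of the exponential gives `exp x ⊗ exp x` up to terms of degree at least `p`. -/
theorem isGroupLikeMod_expTrunc (x : P) {p : ℕ} (hp : 1 ≤ p) :
    F.IsGroupLikeMod p (expTrunc k p (incl k P x)) where
  sub_one_mem := expTrunc_sub_one_mem x hp
  coprod_sub_mem := by
    have hc : Commute (incl k P x ⊗ₜ[k] (1 : UniversalEnvelopingAlgebra k P))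
        ((1 : UniversalEnvelopingAlgebra k P) ⊗ₜ[k] incl k P x) := by
      simp [Commute, SemiconjBy]
    have h := expTrunc_add_sub_mem (k := k) hc p (F.tensorFil p) (by
      intro i j hij
      rw [Algebra.TensorProduct.tmul_pow, Algebra.TensorProduct.tmul_pow,
        Algebra.TensorProduct.tmul_mul_tmul, one_pow, one_pow, one_mul, mul_one]
      exact tmul_mem_tensorFil hij (F.pow_mem_envFil (incl_mem_envFil_one x) _)
        (F.pow_mem_envFil (incl_mem_envFil_one x) _))
    have h1 : expTrunc k p (incl k P x) ⊗ₜ[k] (1 : UniversalEnvelopingAlgebra k P) =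
        expTrunc k p (incl k P x ⊗ₜ[k] (1 : UniversalEnvelopingAlgebra k P)) :=
      map_expTrunc (Algebra.TensorProduct.includeLeft (S := k)) p _
    have h2 : (1 : UniversalEnvelopingAlgebra k P) ⊗ₜ[k] expTrunc k p (incl k P x) =
        expTrunc k p ((1 : UniversalEnvelopingAlgebra k P) ⊗ₜ[k] incl k P x) :=
      map_expTrunc (Algebra.TensorProduct.includeRight : _ →ₐ[k]
        UniversalEnvelopingAlgebra k P ⊗[k] UniversalEnvelopingAlgebra k P) p _
    rw [map_expTrunc, coprod_incl]
    rwa [← h1, ← h2, Algebra.TensorProduct.tmul_mul_tmul, one_mul, mul_one] at h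

/-- `exp•(x) * exp•(y) = exp•(x) • exp•(exp•(x) ▷ y)`. -/
theorem star_exp (x y : P) :
    F.star (F.exp x) (F.exp y) = F.exp x * F.exp (F.act (F.exp x) y) := by
  refine Subtype.ext (funext fun p => ?_)
  -- `F⁰` is all of `U(P)`, so nothing is claimed in degree `0`, where the truncated exponential is
  -- not group-like.
  rcases Nat.eq_zero_or_pos p with rfl | hp
  · obtain ⟨a, ha⟩ := F.exists_rep (F.star (F.exp x) (F.exp y)) 0
    obtain ⟨b, hb⟩ := F.exists_rep (F.exp x * F.exp (F.act (F.exp x) y)) 0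
    rw [← ha, ← hb]
    exact Ideal.Quotient.eq.2 (F.mem_envIdeal.2 (F.mem_envFil_zero _))
  change F.starQuot p ((F.exp x).1 p) ((F.exp y).1 p) =
    (F.exp x).1 p * (F.exp (F.act (F.exp x) y)).1 p
  have hx := isGroupLikeMod_expTrunc (F := F) x hp
  rw [exp_val, exp_val, exp_val, starQuot_mk, hx.mk_starProd, map_mul, hx.mk_envAction_expTrunc,
    envAction_incl]
  congr 1
  -- The completed action is known modulo `Pᵖ` from the truncated exponential, which is all that the
  -- quotient by `Fᵖ` sees.
  have h := F.act_spec (F.exp x) y (exp_val x p).symm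
  have h1 : Ideal.Quotient.mkₐ k (F.envIdeal p) (incl k P (F.act (F.exp x) y)) =
      Ideal.Quotient.mkₐ k (F.envIdeal p)
        (incl k P (triAction k P (expTrunc k p (incl k P x)) y)) := by
    refine Ideal.Quotient.eq.2 (F.mem_envIdeal.2 ?_)
    rw [← map_sub]
    exact letter_mem h
  change Ideal.Quotient.mkₐ k (F.envIdeal p) _ = Ideal.Quotient.mkₐ k (F.envIdeal p) _
  rw [map_expTrunc, map_expTrunc, h1]

end Exponentials

end CompleteFiltration

end PostLieAlgebra

namespace PostLieAlgebra

open scoped TensorProduct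

/-! ### Convolution powers and the Eulerian idempotent. -/

section Convolution

variable {k P : Type*} [Field k] [LieRing P] [LieAlgebra k P]

variable (k P) in
/-- The projection `id - η ε` of the enveloping algebra onto its augmentation ideal. -/
noncomputable def augProj : Module.End k (UniversalEnvelopingAlgebra k P) :=
  LinearMap.id - Algebra.linearMap k _ ∘ₗ (counit k P).toLinearMap

theorem augProj_apply (a : UniversalEnvelopingAlgebra k P) :
    augProj k P a = a - algebraMap k _ (counit k P a) := rfl

variable (k P) in
/-- The convolution powers of `id - η ε`. -/
noncomputable def augConvPow : ℕ → Module.End k (UniversalEnvelopingAlgebra k P)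
  | 0 => Algebra.linearMap k _ ∘ₗ (counit k P).toLinearMap
  | j + 1 => TensorProduct.lift ((LinearMap.mul k _).compl₁₂ (augProj k P) (augConvPow j)) ∘ₗ
      (coprod k P).toLinearMap

theorem augConvPow_zero (a : UniversalEnvelopingAlgebra k P) :
    augConvPow k P 0 a = algebraMap k _ (counit k P a) := rfl

theorem augConvPow_succ (j : ℕ) (a : UniversalEnvelopingAlgebra k P) :
    augConvPow k P (j + 1) a = TensorProduct.lift
      ((LinearMap.mul k _).compl₁₂ (augProj k P) (augConvPow k P j)) (coprod k P a) := rfl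

variable (k P) in
/-- The truncated Eulerian idempotent `∑_{j < N} cⱼ (id - η ε)^{⋆j}`, the convolution logarithm of
the identity. -/
noncomputable def eulerian (N : ℕ) : Module.End k (UniversalEnvelopingAlgebra k P) :=
  ∑ j ∈ Finset.range N, logCoeff k j • augConvPow k P j

theorem eulerian_apply (N : ℕ) (a : UniversalEnvelopingAlgebra k P) :
    eulerian k P N a = ∑ j ∈ Finset.range N, logCoeff k j • augConvPow k P j a := by
  simp [eulerian]

theorem counit_divPow (n : ℕ) (x : P) :
    counit k P (divPow k n (incl k P x)) = if n = 0 then 1 else 0 := by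
  rcases n with _ | n <;> simp [divPow]

theorem augProj_divPow (n : ℕ) (x : P) : augProj k P (divPow k n (incl k P x)) =
    PowerSeries.coeff n (expSubOne k) • incl k P x ^ n := by
  rw [augProj_apply, counit_divPow, expSubOne, PowerSeries.coeff_mk]
  rcases n with _ | n <;> simp [divPow]

variable [CharZero k]

theorem coprod_divPow (n : ℕ) (x : P) : coprod k P (divPow k n (incl k P x)) =
    ∑ m ∈ Finset.HasAntidiagonal.antidiagonal n,
      divPow k m.1 (incl k P x) ⊗ₜ[k] divPow k m.2 (incl k P x) := by
  have hc : Commute (incl k P x ⊗ₜ[k] (1 : UniversalEnvelopingAlgebra k P))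
      ((1 : UniversalEnvelopingAlgebra k P) ⊗ₜ[k] incl k P x) := by
    simp [Commute, SemiconjBy]
  have h : coprod k P (divPow k n (incl k P x)) = divPow k n (coprod k P (incl k P x)) := by
    simp only [divPow, map_smul, map_pow]
  rw [h, coprod_incl, divPow_add hc]
  refine Finset.sum_congr rfl fun m _ => ?_
  simp only [divPow, Algebra.TensorProduct.tmul_pow, smul_mul_smul_comm,
    Algebra.TensorProduct.tmul_mul_tmul, one_pow, one_mul, mul_one, TensorProduct.smul_tmul_smul]

/-- Since `Δ` splits divided powers of `x` as a Cauchy product, convolution becomes multiplication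
of power series; `id - η ε` corresponds to `exp T - 1`. -/
theorem augConvPow_divPow (j n : ℕ) (x : P) : augConvPow k P j (divPow k n (incl k P x)) =
    PowerSeries.coeff n (expSubOne k ^ j) • incl k P x ^ n := by
  induction j generalizing n with
  | zero =>
    rw [augConvPow_zero, counit_divPow, pow_zero, PowerSeries.coeff_one]
    rcases n with _ | n <;> simp
  | succ j ih =>
    rw [augConvPow_succ, coprod_divPow, map_sum, pow_succ', PowerSeries.coeff_mul,
      Finset.sum_smul]
    refine Finset.sum_congr rfl fun m hm => ?_
    rw [TensorProduct.lift.tmul, LinearMap.compl₁₂_apply, LinearMap.mul_apply', augProj_divPow, ih,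
      smul_mul_smul_comm, ← pow_add, Finset.HasAntidiagonal.mem_antidiagonal.1 hm]

/-- This is `log(exp T) = T`, read coefficient by coefficient. -/
theorem eulerian_divPow {N n : ℕ} (h : n < N) (x : P) :
    eulerian k P N (divPow k n (incl k P x)) = if n = 1 then incl k P x else 0 := by
  simp only [eulerian_apply, augConvPow_divPow, smul_smul]
  rw [← Finset.sum_smul, coeff_log_exp k h]
  split_ifs with h1
  · rw [h1, pow_one, one_smul]
  · rw [zero_smul]

theorem eulerian_incl {N : ℕ} (h : 1 < N) (x : P) : eulerian k P N (incl k P x) = incl k P x := by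
  simpa [divPow] using eulerian_divPow (k := k) h x

theorem eulerian_one (N : ℕ) : eulerian k P N 1 = 0 := by
  rcases N with _ | N
  · simp [eulerian]
  · simpa [divPow] using eulerian_divPow (k := k) (Nat.succ_pos N) (0 : P)

theorem eulerian_pow {N n : ℕ} (h : n < N) (h1 : n ≠ 1) (x : P) :
    eulerian k P N (incl k P x ^ n) = 0 := by
  have := eulerian_divPow (k := k) h x
  rw [if_neg h1, divPow, map_smul] at this
  exact (smul_eq_zero.1 this).resolve_left
    (inv_ne_zero (by exact_mod_cast Nat.factorial_ne_zero n))

/-- The Eulerian idempotent kills symmetrized words of length other than one. -/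
theorem eulerian_sum_perm {N n : ℕ} (h : n < N) (h1 : n ≠ 1) (x : Fin n → P) :
    eulerian k P N (∑ σ : Equiv.Perm (Fin n), (List.ofFn fun i => incl k P (x (σ i))).prod) = 0 := by
  rw [sum_perm_ofFn (fun i => incl k P (x i)), map_sum]
  refine Finset.sum_eq_zero fun t _ => ?_
  rw [map_zsmul, ← map_sum, eulerian_pow h h1, smul_zero]

end Convolution

namespace CompleteFiltration

/-! ### Reordering the letters of a word. -/

section Permutation

variable {k P : Type*} [CommRing k] [LieRing P] [LieAlgebra k P] [PostLieAlgebra k P]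
variable {F : CompleteFiltration k P}

/-- Permuting the letters of a word changes it by shorter words of the same weight. -/
theorem perm_word_sub_mem {l l' : List (ℕ × P)} (h : l.Perm l') (hl : IsWord F.fil l) :
    (l'.map fun u => incl k P u.2).prod - (l.map fun u => incl k P u.2).prod ∈ Submodule.span k
      {a | ∃ m : List (ℕ × P), IsWord F.fil m ∧ m.length + 1 = l.length ∧
        (m.map Prod.fst).sum = (l.map Prod.fst).sum ∧
        a = (m.map fun u => incl k P u.2).prod} := by
  induction h with
  | nil => simp
  | cons u h ih =>
    have h1 := Submodule.mem_map_of_mem (f := LinearMap.mulLeft k (incl k P u.2))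
      (ih fun v hv => hl v (by simp [hv]))
    rw [Submodule.map_span, LinearMap.mulLeft_apply, mul_sub] at h1
    simp only [List.map_cons, List.prod_cons]
    refine Submodule.span_mono ?_ h1
    rintro _ ⟨_, ⟨m, hm, h1, h2, rfl⟩, rfl⟩
    refine ⟨u :: m, fun v hv => ?_, by simp [h1], by simp [h2], by simp⟩
    rcases List.mem_cons.1 hv with rfl | hv
    exacts [hl _ (by simp), hm v hv]
  | swap u v l =>
    -- Swapping two adjacent letters costs their bracket: one letter fewer, with the weights added.
    refine Submodule.subset_span ⟨(u.1 + v.1, ⁅u.2, v.2⁆) :: l, fun w hw => ?_, by simp,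
      by simp; omega, ?_⟩
    · rcases List.mem_cons.1 hw with rfl | hw
      · exact F.lie_mem _ _ _ _ (hl u (by simp)) (hl v (by simp))
      · exact hl w (by simp [hw])
    · simp only [List.map_cons, List.prod_cons, incl_lie]
      noncomm_ring
  | trans h1 h2 ih1 ih2 =>
    have hl2 : IsWord F.fil _ := fun v hv => hl v (h1.mem_iff.2 hv)
    have h3 := ih2 hl2
    rw [← h1.length_eq, ← (h1.map Prod.fst).sum_eq] at h3
    have := add_mem h3 (ih1 hl)
    rwa [sub_add_sub_cancel] at this

end Permutation

/-! ### The Eulerian idempotent takes values near `P`; closedness of `P` in `Û(P)`. -/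

section EulerianEstimates

variable {k P : Type*} [Field k] [LieRing P] [LieAlgebra k P] [PostLieAlgebra k P]
variable {F : CompleteFiltration k P}

theorem augProj_mem {p : ℕ} {a : UniversalEnvelopingAlgebra k P} (ha : a ∈ F.envFil p) :
    augProj k P a ∈ F.envFil p := by
  rcases p with _ | p
  · exact F.mem_envFil_zero _
  · rw [augProj_apply, counit_eq_zero (envFil_anti (by omega) ha), map_zero, sub_zero]
    exact ha

theorem augConvPow_mem (j : ℕ) {p : ℕ} {a : UniversalEnvelopingAlgebra k P} (ha : a ∈ F.envFil p) :
    augConvPow k P j a ∈ F.envFil p := by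
  induction j generalizing p a with
  | zero =>
    rcases p with _ | p
    · exact F.mem_envFil_zero _
    · rw [augConvPow_zero, counit_eq_zero (envFil_anti (by omega) ha), map_zero]
      exact zero_mem _
  | succ j ih =>
    rw [augConvPow_succ]
    refine lift_mem_of_mem_tensorFil ?_ (coprod_mem ha)
    intro i i' a b h ha hb
    have h1 := envFil_anti h (envFil_mul (augProj_mem ha) (ih hb))
    simpa using h1

theorem eulerian_mem (N : ℕ) {p : ℕ} {a : UniversalEnvelopingAlgebra k P} (ha : a ∈ F.envFil p) :
    eulerian k P N a ∈ F.envFil p := by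
  rw [eulerian_apply]
  exact Submodule.sum_mem _ fun j _ => Submodule.smul_mem _ _ (augConvPow_mem j ha)

/-- On a group-like element convolution is multiplication, and `id - η ε` takes the value `g - 1`.
-/
theorem IsGroupLikeMod.mk_augConvPow {p : ℕ} {g : UniversalEnvelopingAlgebra k P}
    (hg : F.IsGroupLikeMod p g) (j : ℕ) :
    Ideal.Quotient.mk (F.envIdeal p) (augConvPow k P j g) =
      Ideal.Quotient.mk (F.envIdeal p) (g - 1) ^ j := by
  induction j with
  | zero => rw [augConvPow_zero, hg.counit_eq_one, map_one, map_one, pow_zero]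
  | succ j ih =>
    rw [augConvPow_succ, hg.mk_lift_coprod, LinearMap.compl₁₂_apply, LinearMap.mul_apply', map_mul,
      ih, augProj_apply, hg.counit_eq_one, map_one (algebraMap _ _), pow_succ']
    intro i i' a b h ha hb
    have h1 := envFil_anti h (envFil_mul (augProj_mem ha) (augConvPow_mem j hb))
    simpa using h1

/-- On group-like elements the Eulerian idempotent is the logarithm. -/
theorem IsGroupLikeMod.mk_eulerian {p : ℕ} {g : UniversalEnvelopingAlgebra k P}
    (hg : F.IsGroupLikeMod p g) :
    Ideal.Quotient.mk (F.envIdeal p) (eulerian k P p g) =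
      ∑ j ∈ Finset.range p, logCoeff k j • Ideal.Quotient.mk (F.envIdeal p) (g - 1) ^ j := by
  have h : ∀ a : UniversalEnvelopingAlgebra k P,
    Ideal.Quotient.mk (F.envIdeal p) a = Ideal.Quotient.mkₐ k (F.envIdeal p) a := fun _ => rfl
  have h2 := fun j => hg.mk_augConvPow j
  simp only [h] at h2 ⊢
  simp only [eulerian_apply, map_sum, map_smul, h2]

variable [CharZero k]

/-- Induction on length. The symmetrization of a word of length other than one is killed, and each
reordering changes the word by shorter words of the same weight, so only brackets of the letters,
elements of `P` of that weight, are left. -/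
theorem eulerian_word_mem {N : ℕ} (hN : 1 < N) (n : ℕ) (l : List (ℕ × P)) (hl : IsWord F.fil l)
    (hn : l.length = n) : eulerian k P N (l.map fun u => incl k P u.2).prod ∈
      (F.fil (l.map Prod.fst).sum).map (incl k P) ⊔ F.envFil N := by
  induction n generalizing l with
  | zero =>
    obtain rfl := List.length_eq_zero_iff.1 hn
    simp [eulerian_one]
  | succ n ih =>
    rcases Nat.eq_zero_or_pos n with rfl | hn0
    · obtain ⟨u, rfl⟩ := List.length_eq_one_iff.1 hn
      refine Submodule.mem_sup_left ?_
      simp only [List.map_cons, List.map_nil, List.prod_singleton, eulerian_incl hN,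
        List.sum_singleton]
      exact Submodule.mem_map_of_mem (hl u (by simp))
    -- The vanishing on symmetrized words needs length below `N`. Longer words already lie in `Fᴺ`,
    -- as every letter has weight at least `1`.
    rcases le_or_gt N (n + 1) with hNn | hNn
    · refine Submodule.mem_sup_right (eulerian_mem N (envFil_anti hNn ?_))
      rw [← hn]
      clear ih hn
      induction l with
      | nil => exact F.mem_envFil_zero _
      | cons u l ih =>
        rw [List.map_cons, List.prod_cons, List.length_cons, add_comm]
        exact envFil_mul (incl_mem_envFil_one u.2) (ih fun v hv => hl v (by simp [hv]))
    · have hw : ∀ σ : Equiv.Perm (Fin l.length),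
          eulerian k P N ((List.ofFn fun i => incl k P (l.get (σ i)).2).prod -
            (l.map fun u => incl k P u.2).prod) ∈
          (F.fil (l.map Prod.fst).sum).map (incl k P) ⊔ F.envFil N := by
        intro σ
        have hp : l.Perm (List.ofFn (l.get ∘ σ)) := by
          have := (Equiv.Perm.ofFn_comp_perm σ l.get).symm
          rwa [List.ofFn_get] at this
        have h := perm_word_sub_mem hp hl
        rw [List.map_ofFn] at h
        refine (Submodule.span_le (p := Submodule.comap (eulerian k P N)
          ((F.fil (l.map Prod.fst).sum).map (incl k P) ⊔ F.envFil N))).2 ?_ h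
        rintro _ ⟨m, hm, h1, h2, rfl⟩
        rw [← h2]
        exact ih m hm (by omega)
      have h1 := Submodule.sum_mem _ fun σ (_ : σ ∈ Finset.univ) => hw σ
      rw [← map_sum, Finset.sum_sub_distrib, map_sub,
        eulerian_sum_perm (by omega) (by omega) fun i => (l.get i).2, zero_sub, Finset.sum_const,
        map_nsmul, ← Nat.cast_smul_eq_nsmul k] at h1
      -- The sum over all permutations is minus `n!` times the wanted value, for a word of `n`
      -- letters; characteristic zero permits the division.
      have h2 := Submodule.smul_mem _ ((Finset.univ : Finset (Equiv.Perm (Fin l.length))).card : k)⁻¹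
        (neg_mem h1)
      rw [neg_neg, inv_smul_smul₀] at h2
      · exact h2
      · rw [Finset.card_univ, Fintype.card_perm]
        exact_mod_cast Nat.factorial_ne_zero _

theorem eulerian_mem_sup {N : ℕ} (hN : 1 < N) {p : ℕ} {a : UniversalEnvelopingAlgebra k P}
    (ha : a ∈ F.envFil p) :
    eulerian k P N a ∈ (F.fil p).map (incl k P) ⊔ F.envFil N := by
  refine (Submodule.span_le (p := Submodule.comap (eulerian k P N)
    ((F.fil p).map (incl k P) ⊔ F.envFil N))).2 ?_ ha
  rintro _ ⟨l, hl, hp, rfl⟩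
  have h : (F.fil (l.map Prod.fst).sum).map (incl k P) ⊔ F.envFil N ≤
      (F.fil p).map (incl k P) ⊔ F.envFil N :=
    sup_le_sup (Submodule.map_mono (F.anti hp)) le_rfl
  exact h (eulerian_word_mem hN _ l hl rfl)

/-- An element of `P` in `Fᵖ` is not known to lie in `Pᵖ`. The Eulerian idempotent fixes it and maps
`Fᵖ` into `Pᵖ + Fᵖ⁺¹`, which gives the inclusion up to an error one degree higher. -/
theorem exists_sub_mem (u : P) {p : ℕ} (hu : incl k P u ∈ F.envFil p) :
    ∃ v ∈ F.fil p, incl k P (u - v) ∈ F.envFil (p + 1) := by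
  rcases Nat.eq_zero_or_pos p with rfl | hp
  · exact ⟨u, F.mem_fil_zero u, by simp⟩
  have h := eulerian_mem_sup (N := p + 1) (by omega) hu
  rw [eulerian_incl (by omega)] at h
  obtain ⟨_, ⟨v, hv, rfl⟩, r, hr, h⟩ := Submodule.mem_sup.1 h
  refine ⟨v, hv, ?_⟩
  rw [map_sub, ← h, add_sub_cancel_left]
  exact hr

/-- The image of `P` in `Û(P)` is closed. -/
theorem exists_of_eq (s : F.Completion)
    (h : ∀ p, ∃ u : P, Ideal.Quotient.mk (F.envIdeal p) (incl k P u) = s.1 p) :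
    ∃ z, F.of z = s := by
  have step : ∀ p (u : {u : P // Ideal.Quotient.mk (F.envIdeal p) (incl k P u) = s.1 p}),
      ∃ v : {v : P // Ideal.Quotient.mk (F.envIdeal (p + 1)) (incl k P v) = s.1 (p + 1)},
        v.1 - u.1 ∈ F.fil p := by
    rintro p ⟨u, hu⟩
    obtain ⟨w, hw⟩ := h (p + 1)
    have h1 : incl k P (w - u) ∈ F.envFil p := by
      rw [map_sub]
      exact Ideal.Quotient.eq.1 ((F.rep_eq s hw).trans hu.symm)
    -- The representative `w` may be far from `u` in `P`. Replacing it by `u + v` keeps its class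
    -- modulo `Fᵖ⁺¹` and moves `u` only within `Pᵖ`, so the successive choices are Cauchy.
    obtain ⟨v, hv, hv2⟩ := exists_sub_mem (w - u) h1
    refine ⟨⟨u + v, ?_⟩, by simpa using hv⟩
    rw [← hw]
    refine (Ideal.Quotient.eq.2 (F.mem_envIdeal.2 ?_)).symm
    rwa [← map_sub, ← sub_sub]
  choose next hnext using step
  let t : ∀ p, {u : P // Ideal.Quotient.mk (F.envIdeal p) (incl k P u) = s.1 p} := fun p =>
    Nat.rec ⟨(h 0).choose, (h 0).choose_spec⟩ next p
  obtain ⟨z, hz⟩ := F.complete (fun p => (t p).1) (fun p => hnext p (t p))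
  refine ⟨z, Subtype.ext (funext fun p => ?_)⟩
  rw [← (t p).2]
  refine Ideal.Quotient.eq.2 (F.mem_envIdeal.2 ?_)
  rw [← map_sub]
  exact letter_mem (hz p)

end EulerianEstimates

/-! ### Logarithms of group-like elements lie in `P`. -/

section Logarithms

variable {k P : Type*} [Field k] [LieRing P] [LieAlgebra k P] [PostLieAlgebra k P]
variable {F : CompleteFiltration k P}

theorem log_val (g : F.Completion) (hg : g - 1 ∈ F.augmentation) (p : ℕ) :
    (F.log g hg).1 p = ∑ j ∈ Finset.range p, logCoeff k j • (g.1 p - 1) ^ j := rfl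

/-- At most the coefficient of index `0` enters, and it is `0`. This covers the degrees in which the
truncated Eulerian idempotent does not yet fix `P`. -/
theorem log_val_of_le_one (g : F.Completion) (hg : g - 1 ∈ F.augmentation) {p : ℕ} (hp : p ≤ 1) :
    (F.log g hg).1 p = 0 := by
  rw [log_val]
  refine Finset.sum_eq_zero fun j hj => ?_
  obtain rfl : j = 0 := by have := Finset.mem_range.1 hj; omega
  simp [logCoeff]

theorem log_val_eq_eulerian (g : F.Completion) (hg : g - 1 ∈ F.augmentation) {p : ℕ}
    {a : UniversalEnvelopingAlgebra k P} (ha : F.IsGroupLikeMod p a)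
    (h : Ideal.Quotient.mk (F.envIdeal p) a = g.1 p) :
    (F.log g hg).1 p = Ideal.Quotient.mk (F.envIdeal p) (eulerian k P p a) := by
  rw [log_val, ha.mk_eulerian, ← h, map_sub, map_one]

/-- The choice made by `Classical.epsilon` depends only on the element `g`. Equal elements thus have
equal principal parts, with no appeal to injectivity of `P → Û(P)`. -/
theorem principalPart_congr {g h : F.Completion} (e : g = h) (hg : g - 1 ∈ F.augmentation)
    (hh : h - 1 ∈ F.augmentation) : F.principalPart g hg = F.principalPart h hh := by
  subst e; rfl

theorem log_congr {g h : F.Completion} (e : g = h) (hg : g - 1 ∈ F.augmentation)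
    (hh : h - 1 ∈ F.augmentation) : F.log g hg = F.log h hh := by
  subst e; rfl

variable [CharZero k]

theorem exists_of_eq_log (g : F.Completion) (hg : g - 1 ∈ F.augmentation)
    (h : ∀ p, 1 ≤ p → ∃ a, F.IsGroupLikeMod p a ∧ Ideal.Quotient.mk (F.envIdeal p) a = g.1 p) :
    ∃ z, F.of z = F.log g hg := by
  refine exists_of_eq _ fun p => ?_
  rcases le_or_gt p 1 with hp | hp
  · exact ⟨0, by rw [log_val_of_le_one _ _ hp, map_zero, map_zero]⟩
  obtain ⟨a, ha, hag⟩ := h p hp.le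
  -- The estimate is used in weight `0`, where it puts no condition on `a`: modulo `Fᵖ` the
  -- logarithm is some element of `P`.
  obtain ⟨_, ⟨u, -, rfl⟩, r, hr, hur⟩ :=
    Submodule.mem_sup.1 (eulerian_mem_sup hp (F.mem_envFil_zero a))
  refine ⟨u, ?_⟩
  rw [log_val_eq_eulerian g hg ha hag, ← hur, map_add,
    Ideal.Quotient.eq_zero_iff_mem.2 (F.mem_envIdeal.2 hr), add_zero]

theorem exists_of_eq_log_mul_exp (x y : P) :
    ∃ z, F.of z = F.log (F.exp x * F.exp y) (F.mul_exp_mem x y) := by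
  refine exists_of_eq_log _ _ fun p hp =>
    ⟨_, (isGroupLikeMod_expTrunc x hp).mul (isGroupLikeMod_expTrunc y hp), ?_⟩
  rw [map_mul, ← exp_val, ← exp_val]
  rfl

theorem of_bch (x y : P) :
    F.of (F.bch x y) = F.log (F.exp x * F.exp y) (F.mul_exp_mem x y) :=
  Classical.epsilon_spec (exists_of_eq_log_mul_exp x y)

theorem sharp_eq_bch (x y : P) : F.sharp x y = F.bch x (F.act (F.exp x) y) :=
  principalPart_congr (star_exp x y) _ _

/-- The Eulerian idempotent picks out of the exponential series its linear term. -/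
theorem log_exp (x : P) (h : F.exp x - 1 ∈ F.augmentation) : F.log (F.exp x) h = F.of x := by
  refine Subtype.ext (funext fun p => ?_)
  rcases le_or_gt p 1 with hp | hp
  · rw [log_val_of_le_one _ _ hp]
    exact (Ideal.Quotient.eq_zero_iff_mem.2
      (F.mem_envIdeal.2 (envFil_anti hp (incl_mem_envFil_one x)))).symm
  rw [log_val_eq_eulerian _ h (isGroupLikeMod_expTrunc x hp.le) (exp_val x p).symm, expTrunc,
    map_sum, Finset.sum_congr rfl fun n hn => eulerian_divPow (Finset.mem_range.1 hn) x,
    Finset.sum_ite_eq' _ 1, if_pos (Finset.mem_range.2 hp)]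
  rfl

theorem exp_add (x y : P) (hxy : ⁅x, y⁆ = 0) : F.exp (x + y) = F.exp x * F.exp y := by
  refine Subtype.ext (funext fun p => ?_)
  change (F.exp (x + y)).1 p = (F.exp x).1 p * (F.exp y).1 p
  rw [exp_val, exp_val, exp_val, ← map_mul, map_add]
  refine Ideal.Quotient.eq.2 (F.mem_envIdeal.2 (expTrunc_add_sub_mem ?_ p _ fun i j hij => ?_))
  · have h := incl_lie (k := k) x y
    rw [hxy, map_zero] at h
    exact sub_eq_zero.1 h.symm
  · exact envFil_anti hij (envFil_mul (F.pow_mem_envFil (incl_mem_envFil_one x) i)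
      (F.pow_mem_envFil (incl_mem_envFil_one y) j))

end Logarithms

/-! ### The pre-Lie case. -/

section Abelian

variable {k P : Type*} [CommRing k] [LieRing P] [LieAlgebra k P] [PostLieAlgebra k P]
variable {F : CompleteFiltration k P}

/-- For an abelian Lie algebra `P`, the canonical map `P → Û(P)` is injective. -/
theorem of_injective (hab : ∀ x y : P, ⁅x, y⁆ = 0) : Function.Injective F.of := by
  refine (injective_iff_map_eq_zero _).2 fun x hx => F.separated x fun p => ?_
  rcases Nat.eq_zero_or_pos p with rfl | hp
  · exact F.mem_fil_zero x
  -- The algebra structure on the square-zero extension asks for a right action of `k` as well; it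
  -- is the left one, `k` being commutative.
  let _ : Module kᵐᵒᵖ P := Module.compHom P ((RingHom.id k).fromOpposite mul_comm)
  have _ : IsCentralScalar k P := ⟨fun _ _ => rfl⟩
  -- Elements of `P` commute and multiply to zero in `k ⊕ P`, so `x ↦ (0, x)` extends to `U(P)`
  -- exactly because the bracket vanishes. Its second component recovers `x`.
  let f : UniversalEnvelopingAlgebra k P →ₐ[k] TrivSqZeroExt k P :=
    envLift (TrivSqZeroExt.inrHom k P) (by intro x y; simp [hab])
  have hf : ∀ a ∈ F.envFil p, (f a).snd ∈ F.fil p := by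
    intro a ha
    refine (Submodule.span_le (p := (F.fil p).comap
      (TrivSqZeroExt.sndHom k P ∘ₗ f.toLinearMap))).2 ?_ ha
    rintro _ ⟨l, hl, hpl, rfl⟩
    -- The empty word has weight `0 < p`, a single letter of weight at least `p` lies in `Pᵖ`, and
    -- two or more letters multiply to zero.
    rcases l with _ | ⟨u, _ | ⟨v, l⟩⟩
    · simp at hpl; omega
    · have : u.2 ∈ F.fil p := F.anti (by simpa using hpl) (hl u (by simp))
      simpa [f] using this
    · simp [f, ← mul_assoc]
  have h := hf (incl k P x) (Ideal.Quotient.eq_zero_iff_mem.1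
    (congrFun (congrArg Subtype.val hx) p))
  simpa [f] using h

end Abelian

end CompleteFiltration

end PostLieAlgebra

theorem mainTheorem3 {k P : Type*} [Field k] [CharZero k] [LieRing P] [LieAlgebra k P]
    [PostLieAlgebra k P] (F : PostLieAlgebra.CompleteFiltration k P) :
    (∀ x y : P, F.of (F.sharp x y) = F.log (F.star (F.exp x) (F.exp y)) (F.star_exp_mem x y)) ∧
    (∀ x y : P, F.of (F.bch x y) = F.log (F.exp x * F.exp y) (F.mul_exp_mem x y)) ∧
    (∀ x y : P, F.sharp x y = F.bch x (F.act (F.exp x) y)) ∧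
    ((∀ x y : P, ⁅x, y⁆ = 0) →
      ∀ x y : P, F.bch x y = x + y ∧ F.sharp x y = x + F.act (F.exp x) y) := by
  open PostLieAlgebra.CompleteFiltration in
  have hbch : (∀ x y : P, ⁅x, y⁆ = 0) → ∀ x y : P, F.bch x y = x + y := by
    intro hab x y
    -- Here injectivity is indispensable: `bch` is an arbitrary preimage of the logarithm and must
    -- be identified with `x + y`.
    apply of_injective (F := F) hab
    have e := exp_add (F := F) x y (hab x y)
    rw [of_bch, log_congr e.symm _ (e ▸ F.mul_exp_mem x y), log_exp]
  open PostLieAlgebra.CompleteFiltration in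
  exact ⟨fun x y => by rw [sharp_eq_bch, of_bch, log_congr (star_exp x y)], of_bch, sharp_eq_bch,
    fun hab x y => ⟨hbch hab x y, by rw [sharp_eq_bch, hbch hab]⟩⟩
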